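/- Let $n\ge 2$ and let $v_1,\dots,v_n\in\mathbb R^{n-1}$ be unit vectors pointing to the vertices of an equilateral simplex with $\sum_i v_i=0$. Put $$a_k=\mathbf 1\{k\text{ even}\}\,(-1)^{k/2}\prod_{i=0}^{k/2-1}\frac{2i+1}{n-2i-1},\qquad \sigma_d^2=d!\Big(\frac{n-1}{n}\Big)^d\prod_{i=0}^{d-1}\frac{n-2i}{n-2i-1}.$$ For $S\subseteq[n]$ write $x^S=\prod_{i\in S}x_i$, and let $\widetilde{\mathbb E}:\mathbb R[x_1,\dots,x_n]\to\mathbb R$ be the Grigoriev–Laurent pseudoexpectation: the linear functional with $\widetilde{\mathbb E}[x^S]=a_{|S|}$ for all $S\subseteq[n]$ and $\widetilde{\mathbb E}[x_i^2p]=\widetilde{\mathbb E}[p]$ for all $i$ and $p$. The apolar inner product on $\mathbb R[z_1,\dots,z_{n-1}]$ is the bilinear extension of $\langle p,q\rangle_\circ=\frac1{d!}p(\partial)q$ for $p,q$ homogeneous of the same degree $d$, and $\langle p,q\rangle_\circ=0$ for $p,q$ homogeneous of different degrees. Write $V^\top z=(\langle v_1,z\rangle,\dots,\langle v_n,z\rangle)$,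 and let $V^{(d)}_{\mathcal H}$ be the space of polynomials $q\in\mathbb R[z_1,\dots,z_{n-1}]$, homogeneous of degree $d$, with $\langle v_i,\partial\rangle^2q=0$ for all $i$. 1. $\sigma_d^2>0$ for $0\le d\le\lfloor n/2\rfloor$. 2. (Block diagonalization.) For $|S|=d\le\lfloor n/2\rfloor$ let $$h_S=\frac{\binom nd-\binom n{d-1}}{n!}\sum_{\pi\in S_n}\chi_{(n-d,d)}(\pi)\,x^{\pi(S)},$$ where $\binom n{-1}=0$ and $\chi_{(n-d,d)}$ is the character of the Specht module $W^{(n-d,d)}$ (the $S_n$-module spanned by the polynomials $\prod_{a=1}^d(x_{i_a}-x_{j_a})$ with $i_1,\dots,i_d,j_1,\dots,j_d\in[n]$ distinct). If $|S|,|T|\le\lfloor n/2\rfloor$, then $\widetilde{\mathbb E}[h_Sh_T]=0$ when $|S|\ne|T|$, and $\widetilde{\mathbb E}[h_Sh_T]=\sigma_d^2\,\langle h_S(V^\top z),h_T(V^\top z)\rangle_\circ$ when $|S|=|T|=d$. 3. (Fischer decomposition.) There are polynomials $h_{S,T}\in\mathbb R[x_1,\dots,x_n]$, for $S\subseteq[n]$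 and $T$ a multiset of elements of $[n]$ with $2|T|\le|S|$, homogeneous of degree $|S|-2|T|$, such that for all such $S,T$ $$h_{S,T}(V^\top z)\in V^{(|S|-2|T|)}_{\mathcal H},\qquad \prod_{i\in S}\langle v_i,z\rangle=\sum_{k=0}^{\lfloor|S|/2\rfloor}\ \sum_{|T|=k}h_{S,T}(V^\top z)\prod_{j\in T}\langle v_j,z\rangle^2.\qquad(*)$$ 4. (Gram matrix expression.) Let $h_{S,T}\in\mathbb R[x_1,\dots,x_n]$ be any polynomials satisfying $(*)$. Put $h_{S,k}=\sum_{|T|=(|S|-k)/2}h_{S,T}$ if $k\le|S|$ and $k\equiv|S|\pmod 2$, and $h_{S,k}=0$ otherwise. Then for all $S,T\subseteq[n]$ such that $n$ is even or $|S|+|T|\le n$ (in particular whenever $|S|,|T|\le\lfloor n/2\rfloor$), $$\widetilde{\mathbb E}[x^Sx^T]=\sum_{d=0}^{\min(|S|,|T|)}\sigma_d^2\,\big\langle h_{S,d}(V^\top z),\,h_{T,d}(V^\top z)\big\rangle_\circ=\langle p_S,p_T\rangle_\circ,$$ where $p_S(z)=\sum_{d=0}^{|S|}\sigma_d\,h_{S,d}(V^\top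 z)$ with $\sigma_d=\sqrt{\sigma_d^2}$ (a value $\sigma_d$ that is undefined or not real only multiplies polynomials that do not contribute, and may be set to $0$). -/

import Mathlib

noncomputable section

namespace GrigorievLaurent

/-! ### The pseudoexpectation -/

/-- The constants `a_k = 1{k even} (-1)^(k/2) ∏_{i < k/2} (2i+1)/(n-2i-1)`. -/
def pmoment (n k : ℕ) : ℝ :=
  if Even k then (-1) ^ (k / 2) * ∏ i ∈ Finset.range (k / 2), (2 * (i : ℝ) + 1) / ((n : ℝ) - 2 * i - 1)
  else 0

/-- The Grigoriev–Laurent pseudoexpectation on `ℝ[x_1, …, x_n]`: the linear functional sending a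
monomial `x^m` to `a_k`, where `k` is the number of variables of odd exponent, i.e. the size of
the set `S` with `x^m ≡ x^S` modulo the relations `x_i² = 1`. -/
def pseudoE (n : ℕ) : MvPolynomial (Fin n) ℝ →ₗ[ℝ] ℝ :=
  (MvPolynomial.basisMonomials (Fin n) ℝ).constr ℝ
    fun m => pmoment n (Finset.univ.filter fun i => Odd (m i)).card

/-- The monomial `x^S = ∏_{i ∈ S} x_i`. -/
def setMonomial {n : ℕ} (S : Finset (Fin n)) : MvPolynomial (Fin n) ℝ :=
  ∏ i ∈ S, MvPolynomial.X i

/-- `σ_d² = d! ((n-1)/n)^d ∏_{i < d} (n-2i)/(n-2i-1)`. -/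
def sigmaSq (n d : ℕ) : ℝ :=
  (d.factorial : ℝ) * (((n : ℝ) - 1) / n) ^ d *
    ∏ i ∈ Finset.range d, ((n : ℝ) - 2 * i) / ((n : ℝ) - 2 * i - 1)

/-! ### The apolar inner product -/

lemma pderiv_commute {k : ℕ} (i j : Fin k) :
    Commute ((MvPolynomial.pderiv i : Derivation ℝ (MvPolynomial (Fin k) ℝ) _) :
        Module.End ℝ (MvPolynomial (Fin k) ℝ))
      ((MvPolynomial.pderiv j : Derivation ℝ (MvPolynomial (Fin k) ℝ) _) :
        Module.End ℝ (MvPolynomial (Fin k) ℝ)) := by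
  let D₁ : Derivation ℝ (MvPolynomial (Fin k) ℝ) (MvPolynomial (Fin k) ℝ) := MvPolynomial.pderiv i
  let D₂ : Derivation ℝ (MvPolynomial (Fin k) ℝ) (MvPolynomial (Fin k) ℝ) := MvPolynomial.pderiv j
  have h : ⁅D₁, D₂⁆ = 0 := by
    apply MvPolynomial.derivation_ext
    intro l
    simp only [Derivation.commutator_apply, D₁, D₂, MvPolynomial.pderiv_X, Pi.single_apply]
    split_ifs <;> simp
  refine LinearMap.ext fun p => ?_
  have h2 : ⁅D₁, D₂⁆ p = 0 := by rw [h]; rfl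
  rw [Derivation.commutator_apply, sub_eq_zero] at h2
  exact h2

/-- The differential operator `∂^m = ∏_i ∂_i^{m_i}`. -/
def partialPow {k : ℕ} (m : Fin k →₀ ℕ) : Module.End ℝ (MvPolynomial (Fin k) ℝ) :=
  Finset.univ.noncommProd
    (fun i => ((MvPolynomial.pderiv i : Derivation ℝ (MvPolynomial (Fin k) ℝ) _) :
      Module.End ℝ (MvPolynomial (Fin k) ℝ)) ^ m i)
    (fun i _ j _ _ => (pderiv_commute i j).pow_pow (m i) (m j))

/-- The differential operator `p(∂_1, …, ∂_k)`. -/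
def diffOp {k : ℕ} (p : MvPolynomial (Fin k) ℝ) : Module.End ℝ (MvPolynomial (Fin k) ℝ) :=
  ∑ m ∈ p.support, p.coeff m • partialPow m

/-- The apolar inner product: `(1/d!) p(∂) q` for `p, q` homogeneous of the same degree `d`, zero
for homogeneous polynomials of different degrees, extended bilinearly. (For `p, q` homogeneous of
degree `d`, `p(∂) q` is a constant polynomial; `constantCoeff` reads off its value.) -/
def apolar {k : ℕ} (p q : MvPolynomial (Fin k) ℝ) : ℝ :=
  ∑ d ∈ Finset.range (p.totalDegree + 1), (1 / (d.factorial : ℝ)) *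
    MvPolynomial.constantCoeff
      (diffOp (MvPolynomial.homogeneousComponent d p) (MvPolynomial.homogeneousComponent d q))

/-! ### Simplex vectors and simplex-harmonic polynomials -/

/-- `v_1, …, v_n` are unit vectors pointing to the vertices of an equilateral simplex with
barycenter `0`. -/
structure IsSimplex {n m : ℕ} (v : Fin n → EuclideanSpace ℝ (Fin m)) : Prop where
  norm_eq_one : ∀ i, ‖v i‖ = 1
  equilateral : ∀ i j k l, i ≠ j → k ≠ l → dist (v i) (v j) = dist (v k) (v l)
  sum_eq_zero : ∑ i, v i = 0

/-- The linear form `⟨w, z⟩ ∈ ℝ[z_1, …, z_m]`. -/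
def linForm {m : ℕ} (w : EuclideanSpace ℝ (Fin m)) : MvPolynomial (Fin m) ℝ :=
  ∑ j, MvPolynomial.C (w j) * MvPolynomial.X j

/-- The substitution `p ↦ p(⟨v_1, z⟩, …, ⟨v_n, z⟩)`. -/
def simplexSubst {n m : ℕ} (v : Fin n → EuclideanSpace ℝ (Fin m)) :
    MvPolynomial (Fin n) ℝ →ₐ[ℝ] MvPolynomial (Fin m) ℝ :=
  MvPolynomial.aeval fun i => linForm (v i)

/-- The multiharmonic polynomials of degree `d`: the homogeneous `q` of degree `d` with
`⟨v_i, ∂⟩² q = 0` for all `i`. -/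
def multiharmonic {n m : ℕ} (v : Fin n → EuclideanSpace ℝ (Fin m)) (d : ℕ) :
    Submodule ℝ (MvPolynomial (Fin m) ℝ) :=
  MvPolynomial.homogeneousSubmodule (Fin m) ℝ d ⊓
    ⨅ i, LinearMap.ker (diffOp (linForm (v i)) ^ 2)

/-- The family `(h_{S,T})_T`, for a fixed `S` and `T` ranging over multisets with `2|T| ≤ |S|`, is a
Fischer decomposition of `∏_{i ∈ S} ⟨v_i, z⟩`: each `h_{S,T}(⟨v_1, z⟩, …, ⟨v_n, z⟩)` is
multiharmonic of degree `|S| - 2|T|`, and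
`∏_{i ∈ S} ⟨v_i, z⟩ = ∑_{k ≤ |S|/2} ∑_{|T| = k} h_{S,T}(⟨v_1, z⟩, …) ∏_{j ∈ T} ⟨v_j, z⟩²`. -/
structure IsFischer {n m : ℕ} (v : Fin n → EuclideanSpace ℝ (Fin m)) (S : Finset (Fin n))
    (h : Multiset (Fin n) → MvPolynomial (Fin n) ℝ) : Prop where
  mem_multiharmonic : ∀ T : Multiset (Fin n), 2 * T.card ≤ S.card →
    simplexSubst v (h T) ∈ multiharmonic v (S.card - 2 * T.card)
  prod_eq : ∏ i ∈ S, linForm (v i) =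
    ∑ k ∈ Finset.range (S.card / 2 + 1), ∑ T : Sym (Fin n) k,
      simplexSubst v (h (T : Multiset (Fin n))) *
        ((T : Multiset (Fin n)).map fun j => linForm (v j) ^ 2).prod

/-- `h_{S,k} = ∑_{|T| = (|S|-k)/2} h_{S,T}` if `k ≤ |S|` have equal parity, and `0` otherwise. -/
def fischerPart {n : ℕ} (S : Finset (Fin n)) (h : Multiset (Fin n) → MvPolynomial (Fin n) ℝ)
    (k : ℕ) : MvPolynomial (Fin n) ℝ :=
  if k ≤ S.card ∧ k % 2 = S.card % 2 then
    ∑ T : Sym (Fin n) ((S.card - k) / 2), h (T : Multiset (Fin n))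
  else 0

/-- `p_S(z) = ∑_{d ≤ |S|} σ_d h_{S,d}(⟨v_1, z⟩, …, ⟨v_n, z⟩)`, where `σ_d = √(σ_d²)`. -/
def gramPoly {n m : ℕ} (v : Fin n → EuclideanSpace ℝ (Fin m)) (S : Finset (Fin n))
    (h : Multiset (Fin n) → MvPolynomial (Fin n) ℝ) : MvPolynomial (Fin m) ℝ :=
  ∑ d ∈ Finset.range (S.card + 1), Real.sqrt (sigmaSq n d) • simplexSubst v (fischerPart S h d)

/-! ### Two-row Specht modules and isotypic projections of monomials -/

/-- `S_n` acting on `ℝ[x_1, …, x_n]` by permuting the variables, `π x_i = x_{π i}`. -/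
def permRep (n : ℕ) : Representation ℝ (Equiv.Perm (Fin n)) (MvPolynomial (Fin n) ℝ) where
  toFun π := (MvPolynomial.rename π).toLinearMap
  map_one' := by ext; simp
  map_mul' π τ := by
    refine LinearMap.ext fun p => ?_
    simp [MvPolynomial.rename_rename, Equiv.Perm.coe_mul]

/-- The Specht polynomial `∏_{a ≤ d} (x_{i_a} - x_{j_a})` of a tableau of shape `(n-d, d)` (filled
bijectively with `1, …, n`) whose columns of length two are `(i_a, j_a)`; the columns of length
one contribute trivial factors. Here `f` lists the entries `i_a` (left) and `j_a` (right). -/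
def spechtPoly {n d : ℕ} (f : Fin d ⊕ Fin d ↪ Fin n) : MvPolynomial (Fin n) ℝ :=
  ∏ a : Fin d, (MvPolynomial.X (f (Sum.inl a)) - MvPolynomial.X (f (Sum.inr a)))

/-- The Specht module `W^{(n-d,d)}`: the `S_n`-module of polynomials spanned by the Specht
polynomials of the tableaux of shape `(n-d, d)`. -/
def specht (n d : ℕ) : Subrepresentation (permRep n) where
  toSubmodule := Submodule.span ℝ (Set.range fun f : Fin d ⊕ Fin d ↪ Fin n => spechtPoly f)
  apply_mem_toSubmodule π p hp := by
    induction hp using Submodule.span_induction with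
    | mem x hx =>
      obtain ⟨f, rfl⟩ := hx
      refine Submodule.subset_span ⟨f.trans π.toEmbedding, ?_⟩
      simp [spechtPoly, permRep]
    | zero => simp
    | add x y _ _ hx hy => rw [map_add]; exact Submodule.add_mem _ hx hy
    | smul c x _ hx => rw [map_smul]; exact Submodule.smul_mem _ c hx

/-- The character `χ_{(n-d,d)}` of the Specht module `W^{(n-d,d)}`. -/
def spechtChar (n d : ℕ) (π : Equiv.Perm (Fin n)) : ℝ :=
  (specht n d).toRepresentation.character π

/-- `h_S = (C(n,d) - C(n,d-1))/n! ∑_{π ∈ S_n} χ_{(n-d,d)}(π) x^{π(S)}` for `d = |S|`, with the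
convention `C(n,-1) = 0`. -/
def isoProj {n : ℕ} (S : Finset (Fin n)) : MvPolynomial (Fin n) ℝ :=
  (((n.choose S.card : ℝ) - (if S.card = 0 then 0 else (n.choose (S.card - 1) : ℝ))) /
      (n.factorial : ℝ)) •
    ∑ π : Equiv.Perm (Fin n), spechtChar n S.card π • setMonomial (S.map π.toEmbedding)

end GrigorievLaurent

end

open GrigorievLaurent

namespace GrigorievLaurent

noncomputable section

open MvPolynomial Finset

/-! ### Geometry of the simplex vectors -/

section Simplex

variable {n : ℕ} {v : Fin n → EuclideanSpace ℝ (Fin (n - 1))}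

/-! The functional `pseudoE` kills multiples of `∑ x_i` when `n` is even or the degree is at most
`n` (`pseudoE_sum_X_mul`). In that range it therefore sees only the restriction of a polynomial to
the hyperplane `∑ x_i = 0`. The tight frame `v` identifies functions on this hyperplane with
polynomials in `z`: `simplexSubst v` restricts, and `simplexLift v` is a section of it
(`simplexSubst_simplexLift`, `pseudoE_simplexLift_simplexSubst`).

The lift turns `⟨v_i, ∂⟩` into a multiple of `∂/∂x_i`, so multiharmonic polynomials have multilinear
lifts. For such a lift `Q` of degree `d`, put `x_i = t` on `T` and `x_i = 1` elsewhere. Translation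
invariance along the all-ones vector gives `(t-1)^d Q(1_T)`, while multilinearity gives a polynomial
in `t` recording the sizes `|S ∩ T|`, which are all that the moments `Ẽ[x^S x^T]` depend on. Hence
`Ẽ[Q x^T]` is `Q(1_T)` times a universal constant (`pseudoE_simplexLift_mul_setMonomial`). It
vanishes if `|T| < d`. If `|T| = d` it is a coefficient of `Q` times a constant evaluated by
Chu–Vandermonde. This yields orthogonality of different degrees and the factor `σ_d²` against the
apolar product (`pseudoE_mul_eq_zero`, `pseudoE_mul_eq_apolar`).

The projections `h_S` restrict to multiharmonic polynomials because `∑ ∂_j` kills them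
(`sumPderiv_isoProj`), which gives the block diagonalization. Fischer decompositions come from
splitting multilinear polynomials into the image of the up operator and the kernel of its adjoint `∑
∂_j`; modulo `∑ x_i`, the image consists of squares times lower-degree terms
(`simplexSubst_monomial_mem`). Since `Ẽ` ignores factors `x_j²`, the squares disappear and only the
pairing of multiharmonic parts remains (`IsFischer.pseudoE_setMonomial_mul`). -/

lemma IsSimplex.inner_eq (hv : IsSimplex v) (hn : 2 ≤ n) (i j : Fin n) :
    inner ℝ (v i) (v j) = (n : ℝ) / (n - 1) * (if i = j then 1 else 0) - 1 / ((n : ℝ) - 1) := by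
  have hn1 : (n : ℝ) - 1 ≠ 0 := by
    have : (2 : ℝ) ≤ n := by exact_mod_cast hn
    linarith
  have hself : ∀ i, inner ℝ (v i) (v i) = 1 := fun i => by
    rw [real_inner_self_eq_norm_sq, hv.norm_eq_one]; norm_num
  by_cases hij : i = j
  · subst hij
    rw [hself]; simp; field_simp
  · have hdist : ∀ k l, inner ℝ (v k) (v l) = 1 - dist (v k) (v l) ^ 2 / 2 := fun k l => by
      have := norm_sub_sq_real (v k) (v l)
      rw [dist_eq_norm, this, hv.norm_eq_one, hv.norm_eq_one]; ring
    have hconst : ∀ l, l ≠ i → inner ℝ (v i) (v l) = inner ℝ (v i) (v j) := fun l hl => by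
      rw [hdist, hdist, hv.equilateral i l i j (Ne.symm hl) hij]
    -- Pairing `v i` with the zero barycenter forces the common off-diagonal inner product to be
    -- `-1/(n-1)`.
    have hsum : ∑ l, inner ℝ (v i) (v l) = (0 : ℝ) := by
      rw [← inner_sum, hv.sum_eq_zero, inner_zero_right]
    rw [← Finset.add_sum_erase _ _ (Finset.mem_univ i), hself,
      Finset.sum_congr rfl fun l hl => hconst l (Finset.ne_of_mem_erase hl)] at hsum
    simp only [Finset.sum_const, Finset.card_erase_of_mem (Finset.mem_univ i), Finset.card_univ,
      Fintype.card_fin, nsmul_eq_mul] at hsum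
    rw [Nat.cast_sub (by omega), Nat.cast_one] at hsum
    rw [if_neg hij]
    field_simp
    linarith

lemma IsSimplex.sum_apply (hv : IsSimplex v) (k : Fin (n - 1)) : ∑ i, v i k = 0 := by
  have := congrArg (fun w : EuclideanSpace ℝ (Fin (n - 1)) => w k) hv.sum_eq_zero
  simpa using this

/-- The vectors form a tight frame. -/
lemma IsSimplex.sum_mul (hv : IsSimplex v) (hn : 2 ≤ n) (k l : Fin (n - 1)) :
    ∑ i, v i k * v i l = (n : ℝ) / (n - 1) * (if k = l then 1 else 0) := by
  have hn1 : (n : ℝ) - 1 ≠ 0 := by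
    have : (2 : ℝ) ≤ n := by exact_mod_cast hn
    linarith
  set V : Matrix (Fin n) (Fin (n - 1)) ℝ := Matrix.of fun i k => v i k with hV
  set r : ℝ := (n : ℝ) / (n - 1) with hr
  have hgram : ∀ i j, (V * V.transpose) i j = inner ℝ (v i) (v j) := fun i j => by
    simp [Matrix.mul_apply, PiLp.inner_apply, hV, mul_comm]
  -- `B` is symmetric and the Gram matrix gives `tr B² = 0`, hence `B = 0`. The choice of `r` is
  -- `tr(VᵀV)` divided by the dimension `n - 1`.
  set B : Matrix (Fin (n - 1)) (Fin (n - 1)) ℝ := V.transpose * V - r • 1 with hB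
  have hBsymm : B.conjTranspose = B := by
    simp [hB, Matrix.conjTranspose_eq_transpose_of_trivial, Matrix.transpose_sub,
      Matrix.transpose_mul]
  have htr1 : (V.transpose * V).trace = n := by
    rw [Matrix.trace_mul_comm, Matrix.trace]
    simp only [Matrix.diag_apply, hgram, hv.inner_eq hn]
    simp
    field_simp
  have htr2 : (V.transpose * V * (V.transpose * V)).trace = (n : ℝ) ^ 2 / (n - 1) := by
    rw [Matrix.trace_mul_comm, Matrix.mul_assoc, Matrix.trace_mul_comm, Matrix.mul_assoc,
      Matrix.mul_assoc, ← Matrix.mul_assoc, Matrix.trace]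
    simp only [Matrix.diag_apply, Matrix.mul_apply (M := V * V.transpose), hgram, hv.inner_eq hn]
    simp only [sub_mul, mul_sub, Finset.sum_sub_distrib, mul_ite, ite_mul, mul_one, mul_zero,
      zero_mul, Finset.sum_ite_eq, Finset.sum_ite_eq', Finset.mem_univ, if_true,
      Finset.sum_const, Finset.card_univ, Fintype.card_fin, nsmul_eq_mul]
    field_simp
    ring
  have hB0 : B = 0 := by
    rw [← Matrix.trace_conjTranspose_mul_self_eq_zero_iff, hBsymm, hB]
    simp only [sub_mul, mul_sub, Matrix.trace_sub, htr2, Matrix.smul_mul, Matrix.mul_smul,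
      Matrix.one_mul, Matrix.mul_one, Matrix.trace_smul, htr1, Matrix.trace_one, smul_eq_mul,
      Fintype.card_fin]
    rw [Nat.cast_sub (by omega), Nat.cast_one, hr]
    field_simp
    ring
  have := congrFun (congrFun (sub_eq_zero.1 hB0) k) l
  simpa [Matrix.mul_apply, hV, Matrix.one_apply] using this

end Simplex

/-! ### Chain rule, differential operators -/

lemma derivation_aeval {σ R A : Type*} [Fintype σ] [CommRing R] [CommRing A] [Algebra R A]
    (D : Derivation R A A) (g : σ → A) (p : MvPolynomial σ R) :
    D (aeval g p) = ∑ i, aeval g (pderiv i p) * D (g i) := by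
  classical
  induction p using MvPolynomial.induction_on with
  | C a => simp
  | add p q hp hq => simp [hp, hq, add_mul, Finset.sum_add_distrib]
  | mul_X p j hp =>
    simp only [map_mul, aeval_X, Derivation.leibniz, hp, smul_eq_mul, map_add, pderiv_X,
      add_mul, Finset.sum_add_distrib, Pi.single_apply]
    congr 1
    · simp
    · rw [Finset.mul_sum]
      exact Finset.sum_congr rfl fun i _ => by ring

section DiffOp

variable {k : ℕ}

/-- The partial derivative as an endomorphism. -/
def pd (i : Fin k) : Module.End ℝ (MvPolynomial (Fin k) ℝ) :=
  ((pderiv i : Derivation ℝ (MvPolynomial (Fin k) ℝ) _) : Module.End ℝ (MvPolynomial (Fin k) ℝ))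

lemma pd_apply (i : Fin k) (p : MvPolynomial (Fin k) ℝ) : pd i p = pderiv i p := rfl

lemma pd_pow_commute (m m' : Fin k →₀ ℕ) (i j : Fin k) : Commute (pd i ^ m i) (pd j ^ m' j) :=
  (pderiv_commute i j).pow_pow _ _

lemma pd_pow_pairwise (m : Fin k →₀ ℕ) (s : Finset (Fin k)) :
    (s : Set (Fin k)).Pairwise (Function.onFun Commute fun i => pd i ^ m i) :=
  fun i _ j _ _ => pd_pow_commute m m i j

lemma partialPow_eq (m : Fin k →₀ ℕ) :
    partialPow m = Finset.univ.noncommProd (fun i => pd i ^ m i) (pd_pow_pairwise m _) := rfl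

lemma partialPow_zero : partialPow (0 : Fin k →₀ ℕ) = 1 := by
  rw [partialPow_eq, Finset.noncommProd_eq_pow_card _ _ _ 1 (fun _ _ => by simp), one_pow]

lemma partialPow_add (m m' : Fin k →₀ ℕ) :
    partialPow (m + m') = partialPow m * partialPow m' := by
  have h := Finset.noncommProd_mul_distrib (s := Finset.univ) (fun i => pd i ^ m i)
    (fun i => pd i ^ m' i) (pd_pow_pairwise m _)
    (pd_pow_pairwise m' _) (fun i _ j _ _ => pd_pow_commute m' m i j)
  rw [partialPow_eq, partialPow_eq, partialPow_eq, ← h]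
  exact Finset.noncommProd_congr rfl (fun i _ => by simp [pow_add]) _

lemma partialPow_single (i : Fin k) : partialPow (Finsupp.single i 1) = pd i := by
  have hu : (Finset.univ : Finset (Fin k)) = insert i (Finset.univ.erase i) := by simp
  rw [partialPow_eq]
  refine (Finset.noncommProd_congr hu (fun _ _ => rfl) _).trans ?_
  refine (Finset.noncommProd_insert_of_notMem _ _ _ (pd_pow_pairwise _ _)
    (Finset.notMem_erase i _)).trans ?_
  rw [Finset.noncommProd_eq_pow_card _ _ _ 1, one_pow, mul_one, Finsupp.single_eq_same, pow_one]
  intro j hj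
  rw [Finsupp.single_eq_of_ne (Finset.ne_of_mem_erase hj), pow_zero]

/-- `diffOp` as a linear map. -/
def diffOpLin (k : ℕ) : MvPolynomial (Fin k) ℝ →ₗ[ℝ] Module.End ℝ (MvPolynomial (Fin k) ℝ) :=
  (basisMonomials (Fin k) ℝ).constr ℝ partialPow

/-- The sum over the support hides linearity in `p`; the basis extension exposes it, reducing
identities for `diffOp` to monomials. -/
lemma diffOp_eq (p : MvPolynomial (Fin k) ℝ) : diffOp p = diffOpLin k p := by
  rw [diffOpLin, Module.Basis.constr_apply]
  rfl

lemma diffOpLin_monomial (m : Fin k →₀ ℕ) (a : ℝ) :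
    diffOpLin k (monomial m a) = a • partialPow m := by
  have h : monomial m a = a • basisMonomials (Fin k) ℝ m := by
    simp [smul_monomial]
  rw [h, map_smul, diffOpLin, Module.Basis.constr_basis]

lemma diffOp_X (i : Fin k) : diffOp (X i) = pd i := by
  rw [diffOp_eq, X, diffOpLin_monomial, one_smul, partialPow_single]

lemma diffOp_mul (p q : MvPolynomial (Fin k) ℝ) : diffOp (p * q) = diffOp p * diffOp q := by
  rw [diffOp_eq, diffOp_eq, diffOp_eq]
  induction p using MvPolynomial.induction_on' with
  | monomial m a =>
    induction q using MvPolynomial.induction_on' with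
    | monomial m' a' =>
      rw [monomial_mul, diffOpLin_monomial, diffOpLin_monomial, diffOpLin_monomial,
        partialPow_add, smul_mul_smul_comm]
    | add p q hp hq => rw [mul_add, map_add, hp, hq, map_add, mul_add]
  | add p q hp hq => rw [add_mul, map_add, hp, hq, map_add, add_mul]

lemma diffOp_one : diffOp (1 : MvPolynomial (Fin k) ℝ) = 1 := by
  rw [diffOp_eq, ← C_1, C_apply, diffOpLin_monomial, one_smul, partialPow_zero]

lemma diffOp_linForm (w : EuclideanSpace ℝ (Fin k)) (p : MvPolynomial (Fin k) ℝ) :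
    diffOp (linForm w) p = ∑ j, w j • pderiv j p := by
  simp only [diffOp_eq, linForm, map_sum, ← smul_eq_C_mul, map_smul]
  simp [← diffOp_eq, diffOp_X, pd_apply, LinearMap.sum_apply]

/-- The directional derivative `⟨w, ∂⟩`. -/
def dirDeriv (w : EuclideanSpace ℝ (Fin k)) :
    Derivation ℝ (MvPolynomial (Fin k) ℝ) (MvPolynomial (Fin k) ℝ) :=
  ∑ j, w j • pderiv j

lemma dirDeriv_apply (w : EuclideanSpace ℝ (Fin k)) (p : MvPolynomial (Fin k) ℝ) :
    dirDeriv w p = ∑ j, w j • pderiv j p := by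
  rw [dirDeriv, ← Derivation.coeFnAddMonoidHom_apply (∑ j, w j • pderiv j), map_sum,
    Finset.sum_apply]
  rfl

lemma diffOp_linForm_eq (w : EuclideanSpace ℝ (Fin k)) (p : MvPolynomial (Fin k) ℝ) :
    diffOp (linForm w) p = dirDeriv w p := by
  rw [diffOp_linForm, dirDeriv_apply]

lemma dirDeriv_linForm (w u : EuclideanSpace ℝ (Fin k)) :
    dirDeriv w (linForm u) = C (inner ℝ w u) := by
  rw [dirDeriv_apply]
  simp [linForm, pderiv_X, Pi.single_apply, PiLp.inner_apply, smul_eq_C_mul, mul_comm]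

end DiffOp

end

end GrigorievLaurent

namespace GrigorievLaurent

noncomputable section

open MvPolynomial Finset

/-! ### Polynomials in `z` as functions on the hyperplane `∑ x_i = 0` -/

section Lift

variable {n : ℕ} (v : Fin n → EuclideanSpace ℝ (Fin (n - 1)))

/-- The average of the variables. -/
def meanX (n : ℕ) : MvPolynomial (Fin n) ℝ := C (1 / (n : ℝ)) * ∑ i, X i

/-- The substitution `z = (n-1)/n ∑ i, x_i v_i`, a right inverse of `simplexSubst v`. -/
def simplexLift : MvPolynomial (Fin (n - 1)) ℝ →ₐ[ℝ] MvPolynomial (Fin n) ℝ :=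
  aeval fun j => ∑ i, C (((n : ℝ) - 1) / n * v i j) * X i

lemma linForm_isHomogeneous {m : ℕ} (w : EuclideanSpace ℝ (Fin m)) :
    (linForm w).IsHomogeneous 1 :=
  IsHomogeneous.sum _ _ _ fun j _ => isHomogeneous_C_mul_X (w j) j

lemma simplexSubst_isHomogeneous {p : MvPolynomial (Fin n) ℝ} {d : ℕ} (hp : p.IsHomogeneous d) :
    (simplexSubst v p).IsHomogeneous d := by
  simpa [simplexSubst] using hp.aeval _ fun i => linForm_isHomogeneous (v i)

lemma simplexLift_isHomogeneous {p : MvPolynomial (Fin (n - 1)) ℝ} {d : ℕ}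
    (hp : p.IsHomogeneous d) : (simplexLift v p).IsHomogeneous d := by
  have h := hp.aeval (fun j => ∑ i, C (((n : ℝ) - 1) / n * v i j) * X i)
    fun j => IsHomogeneous.sum univ _ 1 fun i _ => isHomogeneous_C_mul_X (σ := Fin n) _ i
  rwa [one_mul] at h

@[simp] lemma simplexSubst_X (i : Fin n) : simplexSubst v (X i) = linForm (v i) := by
  simp [simplexSubst]

variable {v}

lemma cast_ne_zero_of_two_le (hn : 2 ≤ n) : (n : ℝ) ≠ 0 ∧ (n : ℝ) - 1 ≠ 0 := by
  have : (2 : ℝ) ≤ n := by exact_mod_cast hn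
  constructor <;> linarith

lemma simplexSubst_simplexLift (hv : IsSimplex v) (hn : 2 ≤ n)
    (q : MvPolynomial (Fin (n - 1)) ℝ) : simplexSubst v (simplexLift v q) = q := by
  obtain ⟨h0, h1⟩ := cast_ne_zero_of_two_le hn
  suffices h : (simplexSubst v).comp (simplexLift v) = AlgHom.id ℝ _ from
    congrArg (fun f => f q) h
  ext1 k
  have : ∀ l : Fin (n - 1), ∑ i, ((n : ℝ) - 1) / n * v i k * v i l = if k = l then 1 else 0 := by
    intro l
    simp only [mul_assoc]
    rw [← Finset.mul_sum, hv.sum_mul hn]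
    split_ifs <;> field_simp
  simp only [AlgHom.comp_apply, simplexLift, aeval_X, map_sum, map_mul, algHom_C, simplexSubst_X,
    linForm, AlgHom.id_apply, algebraMap_eq]
  simp_rw [Finset.mul_sum, ← mul_assoc, ← C_mul]
  rw [Finset.sum_comm]
  simp_rw [← Finset.sum_mul, ← map_sum, this]
  simp

/-- Substituting and then lifting is composition with the orthogonal projection onto the hyperplane
`∑ x_i = 0`, here read off from the Gram matrix. -/
lemma simplexLift_linForm (hv : IsSimplex v) (hn : 2 ≤ n) (i : Fin n) :
    simplexLift v (linForm (v i)) = X i - meanX n := by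
  obtain ⟨h0, h1⟩ := cast_ne_zero_of_two_le hn
  have : ∀ l, ∑ j, v i j * (((n : ℝ) - 1) / n) * v l j = (if i = l then 1 else 0) - 1 / n := by
    intro l
    have hin := hv.inner_eq hn i l
    rw [PiLp.inner_apply] at hin
    simp only [RCLike.inner_apply, conj_trivial] at hin
    rw [Finset.sum_congr rfl fun j _ => show v i j * (((n : ℝ) - 1) / n) * v l j =
      ((n : ℝ) - 1) / n * (v l j * v i j) by ring, ← Finset.mul_sum, hin]
    split_ifs <;> field_simp
  simp only [linForm, simplexLift, map_sum, map_mul, algHom_C, aeval_X, algebraMap_eq]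
  simp_rw [Finset.mul_sum, ← mul_assoc, ← C_mul]
  rw [Finset.sum_comm]
  simp_rw [← Finset.sum_mul, ← map_sum, this]
  simp [sub_mul, Finset.sum_sub_distrib, meanX, Finset.mul_sum]

lemma pderiv_simplexLift (i : Fin n) (q : MvPolynomial (Fin (n - 1)) ℝ) :
    pderiv i (simplexLift v q) =
      (((n : ℝ) - 1) / n) • simplexLift v (dirDeriv (v i) q) := by
  rw [dirDeriv_apply, simplexLift, derivation_aeval]
  simp only [map_sum, map_smul, Finset.smul_sum]
  refine Finset.sum_congr rfl fun j _ => ?_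
  simp [pderiv_X, Pi.single_apply, smul_eq_C_mul]
  ring

/-- Chain rule: the diagonal part of the Gram matrix gives `∂_i`, and its constant part gives `∑
∂_j`. -/
lemma dirDeriv_simplexSubst (hv : IsSimplex v) (hn : 2 ≤ n) (i : Fin n)
    (p : MvPolynomial (Fin n) ℝ) :
    dirDeriv (v i) (simplexSubst v p) = simplexSubst v
      (((n : ℝ) / (n - 1)) • pderiv i p - (1 / ((n : ℝ) - 1)) • ∑ j, pderiv j p) := by
  rw [simplexSubst, derivation_aeval]
  simp only [dirDeriv_linForm, hv.inner_eq hn]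
  simp only [map_sub, map_smul, map_sum, mul_sub, Finset.sum_sub_distrib, Finset.smul_sum]
  congr 1
  · simp only [mul_ite, mul_one, mul_zero, smul_eq_C_mul, apply_ite C, map_zero,
      Finset.sum_ite_eq, Finset.mem_univ, if_true]
    exact mul_comm _ _
  · exact Finset.sum_congr rfl fun j _ => by rw [smul_eq_C_mul, mul_comm]

lemma mem_multiharmonic_iff {d : ℕ} {q : MvPolynomial (Fin (n - 1)) ℝ} :
    q ∈ multiharmonic v d ↔
      q.IsHomogeneous d ∧ ∀ i, dirDeriv (v i) (dirDeriv (v i) q) = 0 := by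
  simp [multiharmonic, pow_two, diffOp_linForm_eq, mem_homogeneousSubmodule]

/-- Once `∑ ∂_j` kills `p`, it also kills each `∂_i p`, so both directional derivatives act as
multiples of `∂_i`. -/
lemma simplexSubst_mem_multiharmonic (hv : IsSimplex v) (hn : 2 ≤ n) {d : ℕ}
    {p : MvPolynomial (Fin n) ℝ} (hp : p.IsHomogeneous d) (hp2 : ∀ i, pderiv i (pderiv i p) = 0)
    (hD : ∑ j, pderiv j p = 0) : simplexSubst v p ∈ multiharmonic v d := by
  refine mem_multiharmonic_iff.2 ⟨simplexSubst_isHomogeneous v hp, fun i => ?_⟩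
  have hD' : ∑ j, pderiv j (pderiv i p) = 0 := by
    have : ∀ j, pderiv j (pderiv i p) = pderiv i (pderiv j p) := fun j =>
      congrArg (fun f : Module.End ℝ _ => f p) (pderiv_commute j i)
    simp_rw [this, ← map_sum, hD, map_zero]
  simp [dirDeriv_simplexSubst hv hn, hD, hp2, hD', map_smul]

lemma pderiv_pderiv_simplexLift {d : ℕ} {q : MvPolynomial (Fin (n - 1)) ℝ}
    (hq : q ∈ multiharmonic v d) (i : Fin n) :
    pderiv i (pderiv i (simplexLift v q)) = 0 := by
  simp [pderiv_simplexLift, (mem_multiharmonic_iff.1 hq).2 i]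

end Lift

/-! ### Multilinear polynomials -/

section Multilinear

variable {n : ℕ}

/-- The exponent of `x^S`. -/
def indExp (S : Finset (Fin n)) : Fin n →₀ ℕ := ∑ i ∈ S, Finsupp.single i 1

lemma indExp_apply (S : Finset (Fin n)) (i : Fin n) : indExp S i = if i ∈ S then 1 else 0 := by
  simp [indExp, Finsupp.finsetSum_apply, Finsupp.single_apply]

lemma setMonomial_eq (S : Finset (Fin n)) : setMonomial S = monomial (indExp S) 1 := by
  simp [setMonomial, indExp, monomial_sum_one, X]

lemma setMonomial_isHomogeneous (S : Finset (Fin n)) :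
    (setMonomial S).IsHomogeneous S.card := by
  simpa [setMonomial] using IsHomogeneous.prod S (fun i => (X i : MvPolynomial (Fin n) ℝ)) (fun _ => 1)
    fun i _ => isHomogeneous_X ℝ i

lemma indExp_injective : Function.Injective (indExp : Finset (Fin n) → _) := by
  intro S T h
  ext i
  have := DFunLike.congr_fun h i
  rw [indExp_apply, indExp_apply] at this
  by_cases h1 : i ∈ S <;> by_cases h2 : i ∈ T <;> simp_all

lemma coeff_setMonomial (S T : Finset (Fin n)) :
    coeff (indExp T) (setMonomial S) = if S = T then 1 else 0 := by
  rw [setMonomial_eq, coeff_monomial]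
  simp [indExp_injective.eq_iff]

lemma indExp_add_single {S : Finset (Fin n)} {i : Fin n} (hi : i ∉ S) :
    indExp S + Finsupp.single i 1 = indExp (insert i S) := by
  simp [indExp, Finset.sum_insert hi, add_comm]

lemma degree_indExp (S : Finset (Fin n)) : (indExp S).degree = S.card := by
  simp [indExp]

lemma exists_indExp {m : Fin n →₀ ℕ} (hm : ∀ i, m i ≤ 1) : ∃ S, indExp S = m := by
  refine ⟨Finset.univ.filter fun i => m i = 1, ?_⟩
  ext i
  have := hm i
  rw [indExp_apply]
  simp only [Finset.mem_filter, Finset.mem_univ, true_and]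
  split_ifs <;> omega

/-- Polynomials of degree at most one in every variable. -/
def IsMultilinear (p : MvPolynomial (Fin n) ℝ) : Prop := ∀ i, pderiv i (pderiv i p) = 0

/-- The second derivative multiplies this coefficient by `m i (m i - 1)`, which is nonzero in
characteristic zero. -/
lemma IsMultilinear.coeff_eq_zero {p : MvPolynomial (Fin n) ℝ} (hp : IsMultilinear p)
    {m : Fin n →₀ ℕ} {i : Fin n} (hm : 2 ≤ m i) : coeff m p = 0 := by
  have h := congrArg (coeff (m - Finsupp.single i 2)) (hp i)
  have hm' : m - Finsupp.single i 2 + Finsupp.single i 1 + Finsupp.single i 1 = m := by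
    ext j
    by_cases hj : j = i
    · subst hj; simp; omega
    · simp [Finsupp.single_eq_of_ne hj]
  rw [coeff_pderiv, coeff_pderiv, hm', coeff_zero] at h
  rcases mul_eq_zero.1 h with h | h
  · rcases mul_eq_zero.1 h with h | h
    · exact h
    · exact absurd h (by positivity)
  · exact absurd h (by positivity)

lemma isMultilinear_setMonomial (S : Finset (Fin n)) : IsMultilinear (setMonomial S) := by
  intro i
  ext m
  rw [coeff_pderiv, coeff_pderiv, setMonomial_eq, coeff_monomial, if_neg, coeff_zero]
  · simp
  · intro h
    have := DFunLike.congr_fun h i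
    rw [indExp_apply] at this
    simp at this
    split_ifs at this; omega

lemma IsMultilinear.eq_sum {p : MvPolynomial (Fin n) ℝ} (hp : IsMultilinear p) :
    p = ∑ S, coeff (indExp S) p • setMonomial S := by
  ext m
  rw [coeff_sum]
  by_cases hm : ∀ i, m i ≤ 1
  · obtain ⟨S, rfl⟩ := exists_indExp hm
    simp [coeff_smul, coeff_setMonomial]
  · push Not at hm
    obtain ⟨i, hi⟩ := hm
    rw [hp.coeff_eq_zero hi, Finset.sum_eq_zero]
    intro S _
    rw [coeff_smul, (isMultilinear_setMonomial S).coeff_eq_zero hi, smul_zero]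

lemma isMultilinear_sum {ι : Type*} (s : Finset ι) (f : ι → MvPolynomial (Fin n) ℝ)
    (h : ∀ i ∈ s, IsMultilinear (f i)) : IsMultilinear (∑ i ∈ s, f i) := fun i => by
  rw [map_sum, map_sum]
  exact Finset.sum_eq_zero fun j hj => h j hj i

lemma IsMultilinear.smul {p : MvPolynomial (Fin n) ℝ} (hp : IsMultilinear p) (a : ℝ) :
    IsMultilinear (a • p) := fun i => by simp [hp i]

end Multilinear

end

end GrigorievLaurent

namespace GrigorievLaurent

noncomputable section

open MvPolynomial Finset

/-! ### The apolar inner product -/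

section Apolar

variable {k : ℕ}

lemma apolar_eq_sum_range {p : MvPolynomial (Fin k) ℝ} (q : MvPolynomial (Fin k) ℝ) {N : ℕ}
    (hN : p.totalDegree < N) :
    apolar p q = ∑ d ∈ Finset.range N, (1 / (d.factorial : ℝ)) *
      constantCoeff (diffOp (homogeneousComponent d p) (homogeneousComponent d q)) := by
  refine Finset.sum_subset (Finset.range_mono hN) fun d _ hd => ?_
  rw [homogeneousComponent_eq_zero _ _ (by simpa [Nat.lt_succ_iff] using hd), diffOp_eq, map_zero]
  simp

lemma apolar_eq_of_isHomogeneous {p q : MvPolynomial (Fin k) ℝ} {d : ℕ} (hp : p.IsHomogeneous d)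
    (hq : q.IsHomogeneous d) :
    apolar p q = (1 / (d.factorial : ℝ)) * constantCoeff (diffOp p q) := by
  rw [apolar_eq_sum_range q (Nat.lt_succ_of_le hp.totalDegree_le),
    Finset.sum_eq_single_of_mem d (Finset.self_mem_range_succ d),
    homogeneousComponent_eq_self hp, homogeneousComponent_eq_self hq]
  intro e _ he
  rw [homogeneousComponent_of_mem hp, if_neg he, diffOp_eq, map_zero]
  simp

lemma homogeneousComponent_sum_range {P : ℕ → MvPolynomial (Fin k) ℝ}
    (hP : ∀ d, (P d).IsHomogeneous d) (s : ℕ → ℝ) (a d : ℕ) :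
    homogeneousComponent d (∑ e ∈ Finset.range a, s e • P e) =
      if d < a then s d • P d else 0 := by
  rw [map_sum]
  simp only [map_smul, homogeneousComponent_of_mem (hP _)]
  simp

lemma apolar_sum_sum {P Q : ℕ → MvPolynomial (Fin k) ℝ}
    (hP : ∀ d, (P d).IsHomogeneous d) (hQ : ∀ d, (Q d).IsHomogeneous d) (s : ℕ → ℝ) (a b : ℕ) :
    apolar (∑ d ∈ Finset.range a, s d • P d) (∑ d ∈ Finset.range b, s d • Q d) =
      ∑ d ∈ Finset.range (min a b), s d * s d * apolar (P d) (Q d) := by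
  rw [apolar_eq_sum_range _ (N := max a ((∑ d ∈ Finset.range a, s d • P d).totalDegree + 1))
    (by omega)]
  symm
  refine Finset.sum_subset_zero_on_sdiff (Finset.range_mono (by omega)) ?_ ?_
  · intro d hd
    simp only [Finset.mem_sdiff, Finset.mem_range] at hd
    rw [homogeneousComponent_sum_range hP, homogeneousComponent_sum_range hQ]
    by_cases h1 : d < a
    · rw [if_neg (show ¬ d < b by omega), map_zero, map_zero, mul_zero]
    · rw [if_neg h1, diffOp_eq, map_zero, LinearMap.zero_apply, map_zero, mul_zero]
  · intro d hd
    simp only [Finset.mem_range] at hd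
    rw [homogeneousComponent_sum_range hP, homogeneousComponent_sum_range hQ,
      if_pos (by omega), if_pos (by omega), apolar_eq_of_isHomogeneous (hP d) (hQ d), diffOp_eq,
      diffOp_eq, map_smul, constantCoeff_smul, map_smul, LinearMap.smul_apply, constantCoeff_smul]
    simp only [smul_eq_mul]
    ring

variable {n : ℕ} {v : Fin n → EuclideanSpace ℝ (Fin (n - 1))}

lemma constantCoeff_simplexLift (q : MvPolynomial (Fin (n - 1)) ℝ) :
    constantCoeff (simplexLift v q) = constantCoeff q := by
  induction q using MvPolynomial.induction_on with
  | C a => simp [simplexLift]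
  | add p q hp hq => simp [hp, hq]
  | mul_X p i _ => simp [simplexLift]

/-- Each `⟨v_i, ∂⟩` is `n/(n-1)` times `∂/∂x_i` on the lift. The indices in `S` are distinct, so no
factorials appear. -/
lemma constantCoeff_diffOp_prod (hn : 2 ≤ n) (S : Finset (Fin n))
    (q : MvPolynomial (Fin (n - 1)) ℝ) :
    constantCoeff (diffOp (∏ i ∈ S, linForm (v i)) q) =
      ((n : ℝ) / (n - 1)) ^ S.card * coeff (indExp S) (simplexLift v q) := by
  obtain ⟨h0, h1⟩ := cast_ne_zero_of_two_le hn
  induction S using Finset.induction_on generalizing q with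
  | empty =>
    simp only [Finset.prod_empty, diffOp_one, Module.End.one_apply, indExp, Finset.sum_empty,
      Finset.card_empty, pow_zero, one_mul]
    rw [← constantCoeff_simplexLift (v := v)]
    rfl
  | insert a S ha ih =>
    rw [Finset.prod_insert ha, mul_comm, diffOp_mul, Module.End.mul_apply, diffOp_linForm_eq, ih,
      Finset.card_insert_of_notMem ha, ← indExp_add_single ha]
    have h := congrArg (coeff (indExp S)) (pderiv_simplexLift (v := v) a q)
    rw [coeff_pderiv, coeff_smul, indExp_apply, if_neg ha, smul_eq_mul, Nat.cast_zero, zero_add,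
      mul_one] at h
    rw [h, pow_succ]
    field_simp

lemma IsMultilinear.simplexSubst_eq {p : MvPolynomial (Fin n) ℝ} (hp : IsMultilinear p) :
    simplexSubst v p = ∑ S, coeff (indExp S) p • ∏ i ∈ S, linForm (v i) := by
  conv_lhs => rw [hp.eq_sum]
  simp [setMonomial]

/-- Multilinearity of the lift writes `p` as a combination of products `∏_{i ∈ S} ⟨v_i, z⟩`, and
`constantCoeff_diffOp_prod` evaluates the corresponding differential operators on `q`. -/
lemma apolar_eq_sum (hv : IsSimplex v) (hn : 2 ≤ n) {d : ℕ} {p q : MvPolynomial (Fin (n - 1)) ℝ}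
    (hp : p ∈ multiharmonic v d) (hq : q ∈ multiharmonic v d) :
    apolar p q = (1 / (d.factorial : ℝ)) * (((n : ℝ) / (n - 1)) ^ d *
      ∑ S, coeff (indExp S) (simplexLift v p) * coeff (indExp S) (simplexLift v q)) := by
  have hpm : IsMultilinear (simplexLift v p) := pderiv_pderiv_simplexLift hp
  have hph := simplexLift_isHomogeneous v (mem_multiharmonic_iff.1 hp).1
  rw [apolar_eq_of_isHomogeneous (mem_multiharmonic_iff.1 hp).1 (mem_multiharmonic_iff.1 hq).1]
  congr 1
  conv_lhs => rw [← simplexSubst_simplexLift hv hn p, hpm.simplexSubst_eq]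
  rw [diffOp_eq, map_sum, LinearMap.sum_apply, map_sum, Finset.mul_sum]
  refine Finset.sum_congr rfl fun S _ => ?_
  rw [map_smul, LinearMap.smul_apply, constantCoeff_smul, ← diffOp_eq,
    constantCoeff_diffOp_prod hn]
  by_cases hS : S.card = d
  · rw [hS, smul_eq_mul]; ring
  · rw [hph.coeff_eq_zero (by rwa [degree_indExp])]; simp

end Apolar

/-! ### The pseudoexpectation -/

section Pseudo

variable {n : ℕ}

/-- The variables of odd exponent. -/
def oddVars (m : Fin n →₀ ℕ) : Finset (Fin n) := Finset.univ.filter fun i => Odd (m i)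

lemma mem_oddVars {m : Fin n →₀ ℕ} {i : Fin n} : i ∈ oddVars m ↔ Odd (m i) := by
  simp [oddVars]

lemma pseudoE_monomial (m : Fin n →₀ ℕ) :
    pseudoE n (monomial m 1) = pmoment n (oddVars m).card := by
  have := (basisMonomials (Fin n) ℝ).constr_basis ℝ
    (fun m => pmoment n (Finset.univ.filter fun i => Odd (m i)).card) m
  simpa [pseudoE, oddVars] using this

lemma card_oddVars_le (m : Fin n →₀ ℕ) : (oddVars m).card ≤ m.degree := by
  rw [oddVars, Finset.card_filter, Finsupp.degree_eq_sum]
  refine Finset.sum_le_sum fun i _ => ?_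
  split_ifs with h
  · exact h.pos
  · exact Nat.zero_le _

lemma pmoment_succ_succ {k : ℕ} (hk : Even k) :
    pmoment n (k + 2) = -((k : ℝ) + 1) / ((n : ℝ) - k - 1) * pmoment n k := by
  obtain ⟨j, rfl⟩ := hk
  have h1 : (j + j + 2) / 2 = j + 1 := by omega
  have h2 : (j + j) / 2 = j := by omega
  rw [pmoment, pmoment, if_pos ⟨j + 1, by ring⟩, if_pos ⟨j, rfl⟩, h1, h2, Finset.prod_range_succ,
    pow_succ]
  push_cast
  rw [show (n : ℝ) - (j + j) - 1 = n - 2 * j - 1 by ring]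
  ring

lemma pmoment_of_odd {k : ℕ} (hk : ¬ Even k) : pmoment n k = 0 := by rw [pmoment, if_neg hk]

/-- This is `Ẽ[(∑ x_i) x^S] = 0` for `|S| = k`: a variable in `S` lowers the size by one, and each
of the other `n - k` raises it. The side condition excludes `k = n` odd, where `n a_{n-1}` does not
vanish. -/
lemma pmoment_relation {k : ℕ} (hk : k ≤ n) (hkn : Even n ∨ k + 1 ≤ n) :
    (k : ℝ) * pmoment n (k - 1) + ((n : ℝ) - k) * pmoment n (k + 1) = 0 := by
  by_cases he : Even k
  · rw [pmoment_of_odd (k := k + 1) (by simpa [Nat.even_add_one] using he)]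
    -- At `k = 0` the truncated index `k - 1` does no harm, since its coefficient is zero.
    rcases Nat.eq_zero_or_pos k with rfl | hpos
    · simp
    · rw [pmoment_of_odd (k := k - 1)]
      · simp
      · rw [Nat.even_sub hpos]; simp [he]
  · have hlt : k < n := by
      rcases hkn with h | h
      · exact lt_of_le_of_ne hk fun hh => he (hh ▸ h)
      · exact h
    obtain ⟨j, rfl⟩ : ∃ j, k = j + 1 := ⟨k - 1, by
      have : k ≠ 0 := by rintro rfl; simp at he
      omega⟩
    have hj : Even j := by simpa [Nat.even_add_one] using he
    have : (n : ℝ) - (j + 1 : ℕ) ≠ 0 := by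
      have : ((j + 1 : ℕ) : ℝ) < n := by exact_mod_cast hlt
      linarith
    rw [Nat.add_sub_cancel, pmoment_succ_succ hj]
    push_cast at this ⊢
    rw [show (n : ℝ) - j - 1 = n - (j + 1) by ring]
    field_simp
    ring

lemma oddVars_add_single (m : Fin n →₀ ℕ) (i : Fin n) :
    (oddVars (m + Finsupp.single i 1)).card =
      if i ∈ oddVars m then (oddVars m).card - 1 else (oddVars m).card + 1 := by
  have h : oddVars (m + Finsupp.single i 1) =
      if i ∈ oddVars m then (oddVars m).erase i else insert i (oddVars m) := by
    ext j
    by_cases hj : j = i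
    · subst hj
      split_ifs with h <;> rw [mem_oddVars] at h ⊢ <;> simp_all [mem_oddVars, Nat.odd_add_one]
    · split_ifs with h <;> simp [mem_oddVars, hj, Finsupp.single_eq_of_ne hj]
  rw [h]
  split_ifs with h
  · exact Finset.card_erase_of_mem h
  · exact Finset.card_insert_of_notMem h

lemma pseudoE_sum_X_mul (p : MvPolynomial (Fin n) ℝ) (hp : Even n ∨ p.totalDegree + 1 ≤ n) :
    pseudoE n ((∑ i, X i) * p) = 0 := by
  rw [p.as_sum, Finset.mul_sum, map_sum]
  refine Finset.sum_eq_zero fun m hm => ?_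
  have hm' : monomial m (coeff m p) = coeff m p • monomial m (1 : ℝ) := by
    simp [smul_monomial]
  rw [hm', mul_smul_comm, map_smul, Finset.sum_mul, map_sum]
  refine smul_eq_zero_of_right _ ?_
  have hX : ∀ i, (X i : MvPolynomial (Fin n) ℝ) * monomial m 1 =
      monomial (m + Finsupp.single i 1) 1 := fun i => by
    rw [X, monomial_mul, one_mul, add_comm]
  simp only [hX, pseudoE_monomial, oddVars_add_single, apply_ite (pmoment n)]
  rw [Finset.sum_ite, Finset.sum_const, Finset.sum_const, nsmul_eq_mul, nsmul_eq_mul]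
  have hc : (Finset.univ.filter fun i => i ∉ oddVars m).card = n - (oddVars m).card := by
    rw [Finset.filter_not, Finset.card_sdiff]
    simp
  have hle : (oddVars m).card ≤ n := by simpa using Finset.card_le_univ (oddVars m)
  rw [hc, Nat.cast_sub hle]
  simp only [Finset.filter_mem_eq_inter, Finset.univ_inter]
  refine pmoment_relation hle (hp.imp_right fun h => ?_)
  have := le_totalDegree hm
  have h2 := card_oddVars_le m
  rw [Finsupp.degree_eq_sum] at h2
  rw [Finsupp.sum_fintype _ _ (by simp)] at this
  omega

lemma pseudoE_X_sq_mul (i : Fin n) (p : MvPolynomial (Fin n) ℝ) :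
    pseudoE n (X i ^ 2 * p) = pseudoE n p := by
  induction p using MvPolynomial.induction_on' with
  | add p q hp hq => rw [mul_add, map_add, hp, hq, map_add]
  | monomial m a =>
    have ha : ∀ m : Fin n →₀ ℕ, monomial m a = a • monomial m (1 : ℝ) := fun m => by
      simp [smul_monomial]
    have h : oddVars (Finsupp.single i 2 + m) = oddVars m := by
      ext j
      by_cases hj : j = i
      · subst hj; simp [mem_oddVars, Nat.odd_add, show ¬ Odd 2 by decide]
      · simp [mem_oddVars, Finsupp.single_eq_of_ne hj]
    rw [ha, mul_smul_comm, map_smul, map_smul, X_pow_eq_monomial, monomial_mul, one_mul,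
      pseudoE_monomial, pseudoE_monomial, h]

lemma pseudoE_prod_sq_mul (T : Multiset (Fin n)) (p : MvPolynomial (Fin n) ℝ) :
    pseudoE n ((T.map fun j => X j ^ 2).prod * p) = pseudoE n p := by
  induction T using Multiset.induction_on with
  | empty => simp
  | cons a T ih => rw [Multiset.map_cons, Multiset.prod_cons, mul_assoc, pseudoE_X_sq_mul, ih]

lemma pseudoE_setMonomial_mul (S T : Finset (Fin n)) :
    pseudoE n (setMonomial S * setMonomial T) =
      pmoment n (S.card + T.card - 2 * (S ∩ T).card) := by
  rw [setMonomial_eq, setMonomial_eq, monomial_mul, one_mul, pseudoE_monomial]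
  congr 1
  have h : oddVars (indExp S + indExp T) = (S \ T) ∪ (T \ S) := by
    ext i
    simp only [oddVars, Finset.mem_filter, Finset.mem_univ, true_and, Finsupp.add_apply,
      indExp_apply, Finset.mem_union, Finset.mem_sdiff]
    by_cases h1 : i ∈ S <;> by_cases h2 : i ∈ T <;> simp [h1, h2, Nat.odd_iff]
  rw [h, Finset.card_union_of_disjoint disjoint_sdiff_sdiff]
  have h1 := Finset.card_sdiff_add_card_inter S T
  have h2 := Finset.card_sdiff_add_card_inter T S
  rw [Finset.inter_comm T S] at h2
  omega

lemma totalDegree_prod_X_le (M : Multiset (Fin n)) :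
    ((M.map fun i => (X i : MvPolynomial (Fin n) ℝ)).prod).totalDegree ≤ M.card := by
  refine (totalDegree_multiset_prod _).trans ?_
  simp

lemma totalDegree_meanX_le : (meanX n).totalDegree ≤ 1 := by
  refine IsHomogeneous.totalDegree_le (IsHomogeneous.C_mul ?_ _)
  exact IsHomogeneous.sum _ _ _ fun i _ => isHomogeneous_X ℝ i

/-- The factors are replaced one at a time. Generalizing `r` lets it absorb the factor not yet
treated, and the mean term is a multiple of `∑ x_i`. -/
lemma pseudoE_prod_sub_meanX_mul (M : Multiset (Fin n)) (r : MvPolynomial (Fin n) ℝ)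
    (h : Even n ∨ M.card + r.totalDegree ≤ n) :
    pseudoE n ((M.map fun i => X i - meanX n).prod * r) =
      pseudoE n ((M.map fun i => X i).prod * r) := by
  induction M using Multiset.induction_on generalizing r with
  | empty => rfl
  | cons a M ih =>
    rw [Multiset.map_cons, Multiset.prod_cons, Multiset.map_cons, Multiset.prod_cons,
      mul_comm (X a - meanX n), mul_assoc, ih]
    · have hz : pseudoE n (meanX n * ((M.map fun i => X i).prod * r)) = 0 := by
        rw [meanX, mul_assoc, ← smul_eq_C_mul, map_smul, pseudoE_sum_X_mul, smul_zero]
        refine h.imp_right fun h => ?_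
        have := totalDegree_mul ((M.map fun i => (X i : MvPolynomial (Fin n) ℝ)).prod) r
        have := totalDegree_prod_X_le M
        rw [Multiset.card_cons] at h
        omega
      rw [show (M.map fun i => (X i : MvPolynomial (Fin n) ℝ)).prod * ((X a - meanX n) * r) =
        X a * (M.map fun i => (X i : MvPolynomial (Fin n) ℝ)).prod * r -
          meanX n * ((M.map fun i => X i).prod * r) by ring, map_sub, hz, sub_zero]
    · refine h.imp_right fun h => ?_
      have h1 := totalDegree_mul (X a - meanX n) r
      have h2 := totalDegree_sub (X a) (meanX n)
      have h3 := totalDegree_meanX_le (n := n)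
      have h4 : (X a : MvPolynomial (Fin n) ℝ).totalDegree ≤ 1 := (totalDegree_X a).le
      rw [Multiset.card_cons] at h
      omega

variable {v : Fin n → EuclideanSpace ℝ (Fin (n - 1))}

/-- The pseudoexpectation only depends on the restriction to the hyperplane `∑ x_i = 0`, in low
degree or for even `n`. -/
lemma pseudoE_simplexLift_simplexSubst (hv : IsSimplex v) (hn : 2 ≤ n)
    (p : MvPolynomial (Fin n) ℝ) (hp : Even n ∨ p.totalDegree ≤ n) :
    pseudoE n (simplexLift v (simplexSubst v p)) = pseudoE n p := by
  have hmon : ∀ m : Fin n →₀ ℕ, (Even n ∨ m.degree ≤ n) →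
      pseudoE n (simplexLift v (simplexSubst v (monomial m 1))) = pseudoE n (monomial m 1) := by
    intro m hm
    have hprod : (monomial m 1 : MvPolynomial (Fin n) ℝ) =
        (m.toMultiset.map fun i => X i).prod := by
      rw [Finsupp.toMultiset_map, Finsupp.prod_toMultiset, monomial_eq]
      simp [Finsupp.prod_mapDomain_index, pow_add]
    have h := pseudoE_prod_sub_meanX_mul m.toMultiset 1 (by
      rw [Finsupp.card_toMultiset, totalDegree_one]
      exact hm)
    rw [mul_one, mul_one] at h
    rw [hprod, map_multiset_prod, map_multiset_prod, Multiset.map_map, Multiset.map_map, ← h]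
    congr 3
    funext i
    simp [simplexLift_linForm hv hn]
  rw [p.as_sum]
  simp only [map_sum]
  refine Finset.sum_congr rfl fun m hm => ?_
  have hm' : monomial m (coeff m p) = coeff m p • monomial m (1 : ℝ) := by
    simp [smul_monomial]
  rw [hm', map_smul, map_smul, map_smul, map_smul, hmon m (hp.imp_right fun h => ?_)]
  exact (le_totalDegree hm).trans h

end Pseudo

end

end GrigorievLaurent

namespace GrigorievLaurent

noncomputable section

open MvPolynomial Finset

/-! ### Pairing multiharmonic polynomials -/

/-- A form of the Chu–Vandermonde identity. -/
lemma sum_choose_mul_prod_div (d : ℕ) (a m : ℝ) (hm : ∀ i < d, m - 2 * (i : ℝ) ≠ 0) :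
    ∑ j ∈ Finset.range (d + 1), (d.choose j : ℝ) *
      ∏ i ∈ Finset.range j, (2 * (i : ℝ) + a) / (m - 2 * i) =
    ∏ i ∈ Finset.range d, (m - 2 * (i : ℝ) + a) / (m - 2 * i) := by
  induction d generalizing a m with
  | zero => simp
  | succ d ih =>
    set f : ℕ → ℝ := fun j => ∏ i ∈ Finset.range j, (2 * (i : ℝ) + a) / (m - 2 * i) with hf
    -- Pascal's rule. Shifting the index in the second sum replaces `(a, m)` by `(a + 2, m - 2)`,
    -- which is why the induction generalizes both.
    have hsplit : ∑ j ∈ Finset.range (d + 1 + 1), ((d + 1).choose j : ℝ) * f j =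
        ∑ j ∈ Finset.range (d + 1), (d.choose j : ℝ) * f j +
          ∑ j ∈ Finset.range (d + 1), (d.choose j : ℝ) * f (j + 1) := by
      rw [Finset.sum_range_succ']
      simp only [Nat.choose_succ_succ, Nat.cast_add, add_mul, Finset.sum_add_distrib]
      rw [Finset.sum_range_succ' (fun j => (d.choose j : ℝ) * f j),
        Finset.sum_range_succ (fun j => (d.choose (j + 1) : ℝ) * f (j + 1))]
      simp
      ring
    have hf1 : ∀ j, f (j + 1) = a / m *
        ∏ i ∈ Finset.range j, (2 * (i : ℝ) + (a + 2)) / (m - 2 - 2 * i) := fun j => by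
      rw [hf]
      simp only
      rw [Finset.prod_range_succ', mul_comm]
      congr 1
      · simp
      · refine Finset.prod_congr rfl fun i _ => ?_
        push_cast
        ring_nf
    have hprod1 : ∏ i ∈ Finset.range d, (m - 2 - 2 * (i : ℝ) + (a + 2)) / (m - 2 - 2 * i) =
        (∏ i ∈ Finset.range d, (m - 2 * (i : ℝ) + a)) / ∏ i ∈ Finset.range d, (m - 2 - 2 * i) := by
      rw [Finset.prod_div_distrib]
      congr 1
      exact Finset.prod_congr rfl fun i _ => by ring
    have hm0 : m ≠ 0 := by simpa using hm 0 (Nat.succ_pos d)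
    have hne : ∀ i < d, m - 2 - 2 * (i : ℝ) ≠ 0 := fun i hi => by
      have := hm (i + 1) (by omega)
      push_cast at this
      rwa [show m - 2 * ((i : ℝ) + 1) = m - 2 - 2 * i by ring] at this
    -- Both partial results have numerator `∏ (m - 2i + a)`; this puts them over a common
    -- denominator, and their sum acquires the factor `(m - 2d + a)/(m - 2d)`.
    have hshift : m * ∏ i ∈ Finset.range d, (m - 2 - 2 * (i : ℝ)) =
        (∏ i ∈ Finset.range d, (m - 2 * (i : ℝ))) * (m - 2 * d) := by
      rw [← Finset.prod_range_succ (fun i : ℕ => m - 2 * (i : ℝ)), Finset.prod_range_succ']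
      rw [mul_comm]
      congr 1
      · exact Finset.prod_congr rfl fun i _ => by push_cast; ring
      · simp
    have hP : ∏ i ∈ Finset.range d, (m - 2 * (i : ℝ)) ≠ 0 :=
      Finset.prod_ne_zero_iff.2 fun i hi => hm i (by have := Finset.mem_range.1 hi; omega)
    have hQ : ∏ i ∈ Finset.range d, (m - 2 - 2 * (i : ℝ)) ≠ 0 :=
      Finset.prod_ne_zero_iff.2 fun i hi => hne i (Finset.mem_range.1 hi)
    have hd : m - 2 * (d : ℝ) ≠ 0 := hm d (Nat.lt_succ_self d)
    rw [hsplit, ih a m fun i hi => hm i (by omega)]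
    simp only [hf1]
    rw [Finset.sum_congr rfl fun j _ => mul_left_comm _ (a / m) _, ← Finset.mul_sum,
      ih (a + 2) (m - 2) hne, hprod1, Finset.prod_range_succ, Finset.prod_div_distrib,
      div_mul_div_comm a m, hshift]
    field_simp

lemma IsHomogeneous.aeval_mul {σ A : Type*} [CommRing A] [Algebra ℝ A]
    {q : MvPolynomial σ ℝ} {d : ℕ} (hq : q.IsHomogeneous d) (r : A) (g : σ → A) :
    aeval (fun j => r * g j) q = r ^ d * aeval g q := by
  rw [aeval_def, aeval_def, eval₂_eq, eval₂_eq, Finset.mul_sum]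
  refine Finset.sum_congr rfl fun m hm => ?_
  simp only [mul_pow, Finset.prod_mul_distrib, Finset.prod_pow_eq_pow_sum]
  rw [← hq.degree_eq_sum_deg_support hm]
  ring

section Pairing

variable {n : ℕ} {v : Fin n → EuclideanSpace ℝ (Fin (n - 1))}

/-- The indicator vector of `T`. -/
def indVec (T : Finset (Fin n)) (i : Fin n) : ℝ := if i ∈ T then 1 else 0

/-- The substituted point is `(t-1) 1_T` plus the all-ones vector. Since `∑ v_i = 0`, the lift does
not see the latter, and homogeneity extracts `(t-1)^d`. -/
lemma aeval_simplexLift (hv : IsSimplex v) {d : ℕ} {q : MvPolynomial (Fin (n - 1)) ℝ}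
    (hq : q.IsHomogeneous d) (T : Finset (Fin n)) :
    aeval (fun i => if i ∈ T then (Polynomial.X : Polynomial ℝ) else 1) (simplexLift v q) =
      (Polynomial.X - 1) ^ d * Polynomial.C (eval (indVec T) (simplexLift v q)) := by
  set w : Fin (n - 1) → ℝ := fun j => ∑ i, ((n : ℝ) - 1) / n * v i j * indVec T i with hw
  have h1 : eval (indVec T) (simplexLift v q) = eval w q := by
    rw [← coe_aeval_eq_eval, ← coe_aeval_eq_eval]
    simp only [RingHom.coe_coe, simplexLift, ← AlgHom.comp_apply]
    rw [comp_aeval]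
    congr 2
    funext j
    simp [hw]
  have h2 : aeval (fun i => if i ∈ T then (Polynomial.X : Polynomial ℝ) else 1)
      (simplexLift v q) = aeval (fun j => (Polynomial.X - 1) * Polynomial.C (w j)) q := by
    simp only [simplexLift, ← AlgHom.comp_apply]
    rw [comp_aeval]
    congr 2
    funext j
    have hs : ∑ i, Polynomial.C (((n : ℝ) - 1) / n * v i j) = 0 := by
      rw [← map_sum, ← Finset.mul_sum, hv.sum_apply, mul_zero, map_zero]
    have : ∀ i, (if i ∈ T then (Polynomial.X : Polynomial ℝ) else 1) =
        (Polynomial.X - 1) * Polynomial.C (indVec T i) + 1 := fun i => by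
      by_cases hi : i ∈ T <;> simp [indVec, hi]
    simp only [this, map_sum, map_mul, aeval_X, hw, Finset.mul_sum, mul_add, mul_one,
      Finset.sum_add_distrib, aeval_C, Polynomial.algebraMap_eq]
    simp only [← Polynomial.C_mul]
    rw [hs, add_zero]
    refine Finset.sum_congr rfl fun i _ => ?_
    simp only [Polynomial.C_mul]
    ring
  rw [h2, IsHomogeneous.aeval_mul hq, h1]
  congr 1
  have := aeval_algebraMap_apply (Polynomial ℝ) w q
  simpa [Function.comp_def, coe_aeval_eq_eval] using this

lemma eval_indVec_setMonomial (S T : Finset (Fin n)) :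
    eval (indVec T) (setMonomial S) = if S ⊆ T then 1 else 0 := by
  simp only [setMonomial, map_prod, eval_X, indVec]
  rw [Finset.prod_ite_zero]
  simp [Finset.subset_iff]

lemma eval_indVec {p : MvPolynomial (Fin n) ℝ} (hp : IsMultilinear p) (T : Finset (Fin n)) :
    eval (indVec T) p = ∑ S, if S ⊆ T then coeff (indExp S) p else 0 := by
  conv_lhs => rw [hp.eq_sum]
  simp [eval_indVec_setMonomial, smul_eval]

lemma eval_indVec_eq_zero {p : MvPolynomial (Fin n) ℝ} (hp : IsMultilinear p) {d : ℕ}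
    (hd : p.IsHomogeneous d) {T : Finset (Fin n)} (hT : T.card < d) : eval (indVec T) p = 0 := by
  rw [eval_indVec hp]
  refine Finset.sum_eq_zero fun S _ => ?_
  split_ifs with h
  · refine hd.coeff_eq_zero ?_
    rw [degree_indExp]
    exact ((Finset.card_le_card h).trans_lt hT).ne
  · rfl

lemma eval_indVec_eq_coeff {p : MvPolynomial (Fin n) ℝ} (hp : IsMultilinear p) {d : ℕ}
    (hd : p.IsHomogeneous d) {T : Finset (Fin n)} (hT : T.card = d) :
    eval (indVec T) p = coeff (indExp T) p := by
  rw [eval_indVec hp, Finset.sum_eq_single T]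
  · simp
  · intro S _ hST
    split_ifs with h
    · refine hd.coeff_eq_zero ?_
      rw [degree_indExp, ← hT]
      exact fun hc => hST (Finset.eq_of_subset_of_card_le h hc.ge)
    · rfl
  · simp

/-- The linear functional `X^j ↦ a_{N - 2j}`. -/
def momentFunctional (n N : ℕ) : Polynomial ℝ →ₗ[ℝ] ℝ :=
  (Polynomial.basisMonomials ℝ).constr ℝ fun j => pmoment n (N - 2 * j)

lemma momentFunctional_X_pow (N j : ℕ) :
    momentFunctional n N (Polynomial.X ^ j) = pmoment n (N - 2 * j) := by
  have := (Polynomial.basisMonomials ℝ).constr_basis ℝ (fun j => pmoment n (N - 2 * j)) j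
  simp only [Polynomial.coe_basisMonomials, Polynomial.monomial_one_right_eq_X_pow] at this
  exact this

/-- For `|S| = d`, the moment of `x^S x^T` depends only on `|S ∩ T|`, the exponent of `X` when the
variables in `T` become `X` and the others `1`. Applying `momentFunctional` to the two expressions
for the lift at that point gives the claim. -/
lemma pseudoE_simplexLift_mul_setMonomial (hv : IsSimplex v) {d : ℕ}
    {q : MvPolynomial (Fin (n - 1)) ℝ} (hq : q ∈ multiharmonic v d) (T : Finset (Fin n)) :
    pseudoE n (simplexLift v q * setMonomial T) =
      eval (indVec T) (simplexLift v q) *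
        momentFunctional n (d + T.card) ((Polynomial.X - 1) ^ d) := by
  have hhom := (mem_multiharmonic_iff.1 hq).1
  have hm : IsMultilinear (simplexLift v q) := pderiv_pderiv_simplexLift hq
  have key : aeval (fun i => if i ∈ T then (Polynomial.X : Polynomial ℝ) else 1)
      (simplexLift v q) = ∑ S, coeff (indExp S) (simplexLift v q) •
        (Polynomial.X : Polynomial ℝ) ^ (S ∩ T).card := by
    conv_lhs => rw [hm.eq_sum]
    rw [map_sum]
    refine Finset.sum_congr rfl fun S _ => ?_
    rw [map_smul, setMonomial, map_prod]
    simp only [aeval_X]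
    rw [Finset.prod_ite, Finset.prod_const, Finset.prod_const_one, mul_one,
      Finset.filter_mem_eq_inter]
  have h2 := aeval_simplexLift hv hhom T
  rw [key, mul_comm, ← Polynomial.smul_eq_C_mul] at h2
  have h3 := congrArg (momentFunctional n (d + T.card)) h2
  rw [map_smul, smul_eq_mul] at h3
  rw [← h3]
  conv_lhs => rw [hm.eq_sum]
  rw [Finset.sum_mul, map_sum, map_sum]
  refine Finset.sum_congr rfl fun S _ => ?_
  rw [smul_mul_assoc, map_smul, map_smul, momentFunctional_X_pow, pseudoE_setMonomial_mul]
  by_cases hS : S.card = d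
  · rw [hS]
  · rw [(simplexLift_isHomogeneous v hhom).coeff_eq_zero (by rwa [degree_indExp])]
    simp

/-- The signs of the binomial expansion cancel those of the moments, leaving
`sum_choose_mul_prod_div` with `a = 1` and `m = n - 1`. -/
lemma momentFunctional_X_sub_one_pow {d : ℕ} (hd : ∀ i < d, (n : ℝ) - 1 - 2 * (i : ℝ) ≠ 0) :
    momentFunctional n (d + d) ((Polynomial.X - 1) ^ d) =
      ∏ i ∈ Finset.range d, ((n : ℝ) - 2 * i) / ((n : ℝ) - 2 * i - 1) := by
  have h := sum_choose_mul_prod_div d 1 ((n : ℝ) - 1) hd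
  rw [show ∏ i ∈ Finset.range d, ((n : ℝ) - 2 * i) / ((n : ℝ) - 2 * i - 1) =
    ∏ i ∈ Finset.range d, ((n : ℝ) - 1 - 2 * (i : ℝ) + 1) / (n - 1 - 2 * i) from
    Finset.prod_congr rfl fun i _ => by ring_nf, ← h, sub_eq_neg_add, add_pow, map_sum]
  refine Finset.sum_congr rfl fun j hj => ?_
  have hj' : j ≤ d := Nat.lt_succ_iff.1 (Finset.mem_range.1 hj)
  have : (-1 : Polynomial ℝ) ^ j * Polynomial.X ^ (d - j) * (d.choose j : Polynomial ℝ) =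
      ((d.choose j : ℝ) * (-1) ^ j) • (Polynomial.X : Polynomial ℝ) ^ (d - j) := by
    rw [Polynomial.smul_eq_C_mul]
    simp
    ring
  rw [this, map_smul, momentFunctional_X_pow, show d + d - 2 * (d - j) = 2 * j by omega,
    pmoment, if_pos (even_two_mul j), Nat.mul_div_cancel_left j two_pos, smul_eq_mul, mul_assoc,
    ← mul_assoc ((-1 : ℝ) ^ j), ← mul_pow]
  simp only [neg_mul_neg, one_mul, one_pow]
  congr 1
  exact Finset.prod_congr rfl fun i _ => by ring_nf

/-- The lift of `q` involves only monomials `x^T` with `|T| = e < d`, and the lift of `p` vanishes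
at every such indicator vector. -/
lemma pseudoE_mul_eq_zero_of_lt (hv : IsSimplex v) {d e : ℕ} (hde : e < d)
    {p q : MvPolynomial (Fin (n - 1)) ℝ} (hp : p ∈ multiharmonic v d)
    (hq : q ∈ multiharmonic v e) : pseudoE n (simplexLift v p * simplexLift v q) = 0 := by
  have hqm : IsMultilinear (simplexLift v q) := pderiv_pderiv_simplexLift hq
  rw [hqm.eq_sum, Finset.mul_sum, map_sum]
  refine Finset.sum_eq_zero fun T _ => ?_
  rw [mul_smul_comm, map_smul, pseudoE_simplexLift_mul_setMonomial hv hp]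
  by_cases hT : T.card = e
  · rw [eval_indVec_eq_zero (pderiv_pderiv_simplexLift hp)
      (simplexLift_isHomogeneous v (mem_multiharmonic_iff.1 hp).1) (hT ▸ hde)]
    simp
  · rw [(simplexLift_isHomogeneous v (mem_multiharmonic_iff.1 hq).1).coeff_eq_zero
      (by rwa [degree_indExp])]
    simp

lemma pseudoE_mul_eq_zero (hv : IsSimplex v) {d e : ℕ} (hde : d ≠ e)
    {p q : MvPolynomial (Fin (n - 1)) ℝ} (hp : p ∈ multiharmonic v d)
    (hq : q ∈ multiharmonic v e) : pseudoE n (simplexLift v p * simplexLift v q) = 0 := by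
  rcases lt_or_gt_of_ne hde with h | h
  · rw [mul_comm]; exact pseudoE_mul_eq_zero_of_lt hv h hq hp
  · exact pseudoE_mul_eq_zero_of_lt hv h hp hq

lemma pseudoE_mul_eq_apolar (hv : IsSimplex v) (hn : 2 ≤ n) {d : ℕ} (hd : Even n ∨ d + d ≤ n)
    {p q : MvPolynomial (Fin (n - 1)) ℝ} (hp : p ∈ multiharmonic v d)
    (hq : q ∈ multiharmonic v d) :
    pseudoE n (simplexLift v p * simplexLift v q) = sigmaSq n d * apolar p q := by
  obtain ⟨h0, h1⟩ := cast_ne_zero_of_two_le hn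
  -- A vanishing denominator would mean `n = 2i + 1` with `i < d`, excluded both by evenness and by
  -- `2d ≤ n`.
  have hne : ∀ i < d, (n : ℝ) - 1 - 2 * (i : ℝ) ≠ 0 := by
    intro i hi hz
    have : n = 2 * i + 1 := by
      have : (n : ℝ) = ((2 * i + 1 : ℕ) : ℝ) := by push_cast; linarith
      exact_mod_cast this
    rcases hd with h | h
    · rw [this] at h
      exact absurd h (by simp)
    · omega
  have hqm : IsMultilinear (simplexLift v q) := pderiv_pderiv_simplexLift hq
  rw [apolar_eq_sum hv hn hp hq]
  conv_lhs => rw [hqm.eq_sum, Finset.mul_sum, map_sum]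
  rw [sigmaSq, ← mul_assoc, ← mul_assoc, Finset.mul_sum]
  refine Finset.sum_congr rfl fun T _ => ?_
  rw [mul_smul_comm, map_smul, pseudoE_simplexLift_mul_setMonomial hv hp, smul_eq_mul]
  by_cases hT : T.card = d
  · rw [eval_indVec_eq_coeff (pderiv_pderiv_simplexLift hp)
      (simplexLift_isHomogeneous v (mem_multiharmonic_iff.1 hp).1) hT, hT,
      momentFunctional_X_sub_one_pow hne]
    have hc : (((n : ℝ) - 1) / n) ^ d * ((n : ℝ) / (n - 1)) ^ d = 1 := by
      rw [← mul_pow, div_mul_div_comm, mul_comm ((n : ℝ) - 1), div_self (mul_ne_zero h0 h1),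
        one_pow]
    have hf : (d.factorial : ℝ) * (1 / d.factorial) = 1 :=
      mul_one_div_cancel (by exact_mod_cast d.factorial_ne_zero)
    set P := ∏ i ∈ Finset.range d, ((n : ℝ) - 2 * i) / ((n : ℝ) - 2 * i - 1)
    set A := (((n : ℝ) - 1) / n) ^ d
    set B := ((n : ℝ) / (n - 1)) ^ d
    linear_combination (-(P * coeff (indExp T) (simplexLift v p) *
      coeff (indExp T) (simplexLift v q))) * (hc + (A * B) * hf)
  · rw [(simplexLift_isHomogeneous v (mem_multiharmonic_iff.1 hq).1).coeff_eq_zero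
      (by rwa [degree_indExp])]
    simp

end Pairing

end

end GrigorievLaurent

namespace GrigorievLaurent

noncomputable section

open MvPolynomial Finset

/-! ### Isotypic projections of monomials -/

section IsoProj

variable {n : ℕ}

/-- The sum of all partial derivatives. -/
def sumPderiv (n : ℕ) : MvPolynomial (Fin n) ℝ →ₗ[ℝ] MvPolynomial (Fin n) ℝ where
  toFun p := ∑ j, pderiv j p
  map_add' p q := by simp [Finset.sum_add_distrib]
  map_smul' a p := by simp [Finset.smul_sum]

lemma sumPderiv_apply (p : MvPolynomial (Fin n) ℝ) : sumPderiv n p = ∑ j, pderiv j p := rfl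

lemma sumPderiv_rename (π : Equiv.Perm (Fin n)) (p : MvPolynomial (Fin n) ℝ) :
    sumPderiv n (rename π p) = rename π (sumPderiv n p) := by
  rw [sumPderiv_apply, sumPderiv_apply, map_sum, ← Equiv.sum_comp π]
  exact Finset.sum_congr rfl fun j _ => pderiv_rename π.injective j p

lemma rename_setMonomial (π : Equiv.Perm (Fin n)) (S : Finset (Fin n)) :
    rename π (setMonomial S) = setMonomial (S.map π.toEmbedding) := by
  simp [setMonomial]

lemma pderiv_setMonomial (S : Finset (Fin n)) (j : Fin n) :
    pderiv j (setMonomial S) = if j ∈ S then setMonomial (S.erase j) else 0 := by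
  split_ifs with hj
  · rw [← Finset.insert_erase hj, setMonomial, Finset.prod_insert (Finset.notMem_erase j S),
      Finset.erase_insert (Finset.notMem_erase j S), Derivation.leibniz, pderiv_X_self]
    have : pderiv j (∏ i ∈ S.erase j, (X i : MvPolynomial (Fin n) ℝ)) = 0 := by
      refine pderiv_eq_zero_of_notMem_vars fun h => ?_
      obtain ⟨i, hi, hi'⟩ := Finset.mem_biUnion.1 (vars_prod _ h)
      rw [vars_X, Finset.mem_singleton] at hi'
      exact Finset.ne_of_mem_erase hi hi'.symm
    rw [this]
    simp [setMonomial]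
  · refine pderiv_eq_zero_of_notMem_vars fun h => ?_
    obtain ⟨i, hi, hi'⟩ := Finset.mem_biUnion.1 (vars_prod _ h)
    rw [vars_X, Finset.mem_singleton] at hi'
    exact hj (hi' ▸ hi)

/-- Pigeonhole: fewer than `d` elements cannot meet all of `d` disjoint pairs. -/
lemma exists_pair_notMem {d : ℕ} (f : Fin d ⊕ Fin d ↪ Fin n) {R : Finset (Fin n)}
    (hR : R.card < d) : ∃ a, f (Sum.inl a) ∉ R ∧ f (Sum.inr a) ∉ R := by
  classical
  by_contra! h
  have : (Finset.univ : Finset (Fin d)).card ≤ R.card := by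
    refine Finset.card_le_card_of_injOn
      (fun a => if f (Sum.inl a) ∈ R then f (Sum.inl a) else f (Sum.inr a)) ?_ ?_
    · intro a _
      by_cases ha : f (Sum.inl a) ∈ R
      · simp [ha]
      · simpa [ha] using h a ha
    · intro a _ b _ hab
      by_cases ha : f (Sum.inl a) ∈ R <;> by_cases hb : f (Sum.inl b) ∈ R <;>
        simp [ha, hb] at hab <;> exact hab
  simp at this
  omega

lemma rename_swap_spechtPoly {d : ℕ} (f : Fin d ⊕ Fin d ↪ Fin n) (a : Fin d) :
    rename (Equiv.swap (f (Sum.inl a)) (f (Sum.inr a))) (spechtPoly f) = -spechtPoly f := by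
  rw [spechtPoly, map_prod, ← Finset.mul_prod_erase _ _ (Finset.mem_univ a),
    ← Finset.mul_prod_erase Finset.univ
      (fun b => (X (f (Sum.inl b)) - X (f (Sum.inr b)) : MvPolynomial (Fin n) ℝ))
      (Finset.mem_univ a), ← neg_mul]
  congr 1
  · simp
  · refine Finset.prod_congr rfl fun b hb => ?_
    have hb := Finset.ne_of_mem_erase hb
    rw [map_sub, rename_X, rename_X, Equiv.swap_apply_of_ne_of_ne, Equiv.swap_apply_of_ne_of_ne]
    all_goals simp [hb]

lemma rename_swap_setMonomial {R : Finset (Fin n)} {i j : Fin n} (hi : i ∉ R) (hj : j ∉ R) :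
    rename (Equiv.swap i j) (setMonomial R) = setMonomial R := by
  rw [setMonomial, map_prod]
  refine Finset.prod_congr rfl fun k hk => ?_
  rw [rename_X, Equiv.swap_apply_of_ne_of_ne]
  · rintro rfl; exact hi hk
  · rintro rfl; exact hj hk

/-- Some column of the tableau avoids `R`; swapping its entries negates the Specht polynomial and
fixes `x^R`, so the sum equals its own negative. -/
lemma sum_smul_rename_setMonomial_eq_zero {d : ℕ} {R : Finset (Fin n)} (hR : R.card < d)
    (g : MvPolynomial (Fin n) ℝ →ₗ[ℝ] ℝ) {w : MvPolynomial (Fin n) ℝ}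
    (hw : w ∈ (specht n d).toSubmodule) :
    ∑ π : Equiv.Perm (Fin n), g (rename π w) • rename π (setMonomial R) = 0 := by
  induction hw using Submodule.span_induction with
  | mem x hx =>
    obtain ⟨f, rfl⟩ := hx
    obtain ⟨a, h1, h2⟩ := exists_pair_notMem f hR
    set τ := Equiv.swap (f (Sum.inl a)) (f (Sum.inr a)) with hτ
    have h : ∑ π : Equiv.Perm (Fin n), g (rename π (spechtPoly f)) • rename π (setMonomial R) =
        -∑ π : Equiv.Perm (Fin n), g (rename π (spechtPoly f)) • rename π (setMonomial R) := by
      conv_lhs => rw [← Equiv.sum_comp (Equiv.mulRight τ)]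
      rw [← Finset.sum_neg_distrib]
      refine Finset.sum_congr rfl fun π _ => ?_
      rw [Equiv.coe_mulRight, Equiv.Perm.coe_mul, ← rename_rename, ← rename_rename,
        rename_swap_spechtPoly, rename_swap_setMonomial h1 h2, map_neg, map_neg, neg_smul]
    exact self_eq_neg.1 h
  | zero => simp
  | add x y _ _ hx hy => simp only [map_add, add_smul, Finset.sum_add_distrib, hx, hy, add_zero]
  | smul c x _ hx =>
    simp only [map_smul, smul_eq_mul, mul_smul, ← Finset.smul_sum, hx, smul_zero]

instance (d : ℕ) : Module.Finite ℝ (specht n d).toSubmodule :=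
  FiniteDimensional.span_of_finite ℝ (Set.finite_range _)

/-- The character is a sum of diagonal matrix coefficients, and the previous cancellation applies to
each. Irreducibility of the Specht module plays no role. -/
lemma sum_spechtChar_smul_setMonomial {d : ℕ} {R : Finset (Fin n)} (hR : R.card < d) :
    ∑ π : Equiv.Perm (Fin n), spechtChar n d π • rename π (setMonomial R) = 0 := by
  classical
  set b := Module.Free.chooseBasis ℝ (specht n d).toSubmodule
  have hχ : ∀ π, spechtChar n d π =
      ∑ k, b.coord k ((specht n d).toRepresentation π (b k)) := fun π => by
    rw [spechtChar, Representation.character, LinearMap.trace_eq_matrix_trace ℝ b, Matrix.trace]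
    refine Finset.sum_congr rfl fun k _ => ?_
    rw [Matrix.diag_apply, LinearMap.toMatrix_apply]
    rfl
  simp only [hχ, Finset.sum_smul]
  rw [Finset.sum_comm]
  refine Finset.sum_eq_zero fun k _ => ?_
  -- The coordinate functional lives on the Specht module; extending it to all polynomials makes it
  -- applicable to renamings in the ambient ring.
  obtain ⟨g, hg⟩ := LinearMap.exists_extend (b.coord k)
  have := sum_smul_rename_setMonomial_eq_zero hR g (b k).2
  rw [← this]
  refine Finset.sum_congr rfl fun π _ => ?_
  rw [← hg]
  rfl

lemma isoProj_eq (S : Finset (Fin n)) : ∃ c : ℝ, isoProj S =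
    c • ∑ π : Equiv.Perm (Fin n), spechtChar n S.card π • rename π (setMonomial S) :=
  ⟨_, by simp only [rename_setMonomial]; rfl⟩

lemma isMultilinear_isoProj (S : Finset (Fin n)) : IsMultilinear (isoProj S) :=
  (isMultilinear_sum _ _ fun _ _ => (isMultilinear_setMonomial _).smul _).smul _

lemma isoProj_isHomogeneous (S : Finset (Fin n)) : (isoProj S).IsHomogeneous S.card := by
  rw [← mem_homogeneousSubmodule]
  refine Submodule.smul_mem _ _ (Submodule.sum_mem _ fun π _ => Submodule.smul_mem _ _ ?_)
  have := setMonomial_isHomogeneous (S.map π.toEmbedding)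
  rwa [Finset.card_map] at this

/-- `∑ ∂_j` commutes with permutations and sends `x^S` to monomials of size `|S| - 1`, too small to
survive the sum against the character. -/
lemma sumPderiv_isoProj (S : Finset (Fin n)) : sumPderiv n (isoProj S) = 0 := by
  obtain ⟨c, hc⟩ := isoProj_eq S
  rw [hc, map_smul, map_sum]
  simp only [map_smul, sumPderiv_rename]
  have : sumPderiv n (setMonomial S) = ∑ j ∈ S, setMonomial (S.erase j) := by
    simp [sumPderiv_apply, pderiv_setMonomial]
  simp only [this, map_sum, Finset.smul_sum]
  rw [Finset.sum_comm]
  refine Finset.sum_eq_zero fun j hj => ?_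
  rw [← Finset.smul_sum,
    sum_spechtChar_smul_setMonomial (Finset.card_erase_lt_of_mem hj), smul_zero]

variable {v : Fin n → EuclideanSpace ℝ (Fin (n - 1))}

lemma simplexSubst_isoProj_mem (hv : IsSimplex v) (hn : 2 ≤ n) (S : Finset (Fin n)) :
    simplexSubst v (isoProj S) ∈ multiharmonic v S.card :=
  simplexSubst_mem_multiharmonic hv hn (isoProj_isHomogeneous S) (isMultilinear_isoProj S)
    (sumPderiv_isoProj S)

lemma pseudoE_isoProj_mul (hv : IsSimplex v) (hn : 2 ≤ n) (S T : Finset (Fin n))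
    (hST : S.card + T.card ≤ n) : pseudoE n (isoProj S * isoProj T) =
      pseudoE n (simplexLift v (simplexSubst v (isoProj S)) *
        simplexLift v (simplexSubst v (isoProj T))) := by
  rw [← map_mul, ← map_mul, pseudoE_simplexLift_simplexSubst hv hn]
  exact Or.inr (((isoProj_isHomogeneous S).mul (isoProj_isHomogeneous T)).totalDegree_le.trans hST)

lemma sigmaSq_pos (hn : 2 ≤ n) {d : ℕ} (hd : d ≤ n / 2) : 0 < sigmaSq n d := by
  have h2 : (2 : ℝ) ≤ n := by exact_mod_cast hn
  refine mul_pos (mul_pos (by exact_mod_cast d.factorial_pos)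
    (pow_pos (div_pos (by linarith) (by linarith)) _)) (Finset.prod_pos fun i hi => ?_)
  have hi : 2 * i + 2 ≤ n := by have := Finset.mem_range.1 hi; omega
  have hi' : 2 * (i : ℝ) + 2 ≤ n := by exact_mod_cast hi
  exact div_pos (by linarith) (by linarith)

/-- For `n = 2k` and `d > k`, the product contains the factor `n - 2k = 0`, so the constant is zero.
-/
lemma sigmaSq_nonneg (hn : 2 ≤ n) {d : ℕ} (hd : Even n ∨ d ≤ n / 2) : 0 ≤ sigmaSq n d := by
  by_cases h : d ≤ n / 2
  · exact (sigmaSq_pos hn h).le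
  · obtain ⟨k, rfl⟩ := hd.resolve_right h
    rw [sigmaSq, Finset.prod_eq_zero (i := k) (Finset.mem_range.2 (by omega)), mul_zero]
    push_cast
    ring

end IsoProj

end

end GrigorievLaurent

namespace GrigorievLaurent

noncomputable section

open MvPolynomial Finset

/-! ### Fischer decomposition -/

section Fischer

variable {n : ℕ}

/-- The image of `x^R` under the up operator of the Boolean lattice. -/
def upPoly (R : Finset (Fin n)) : MvPolynomial (Fin n) ℝ :=
  ∑ i ∈ Rᶜ, setMonomial (insert i R)

lemma upPoly_isHomogeneous (R : Finset (Fin n)) : (upPoly R).IsHomogeneous (R.card + 1) := by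
  refine IsHomogeneous.sum _ _ _ fun i hi => ?_
  have := setMonomial_isHomogeneous (insert i R)
  rwa [Finset.card_insert_of_notMem (Finset.mem_compl.1 hi)] at this

/-- After restriction to `∑ x_i = 0` only squares times square-free monomials of lower degree
remain, which drives the Fischer induction. -/
lemma upPoly_eq (R : Finset (Fin n)) :
    upPoly R = (∑ i, X i) * setMonomial R - ∑ i ∈ R, X i ^ 2 * setMonomial (R.erase i) := by
  rw [eq_sub_iff_add_eq, Finset.sum_mul, ← Finset.sum_compl_add_sum R]
  congr 1
  · refine Finset.sum_congr rfl fun i hi => ?_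
    rw [setMonomial, Finset.prod_insert (Finset.mem_compl.1 hi), setMonomial]
  · refine Finset.sum_congr rfl fun i hi => ?_
    rw [setMonomial, setMonomial, ← Finset.mul_prod_erase R _ hi]
    ring

/-- On multilinear polynomials `∑ ∂_j` is the down operator, adjoint to `upPoly` in the monomial
basis. -/
lemma coeff_sumPderiv_indExp {p : MvPolynomial (Fin n) ℝ} (hp : IsMultilinear p)
    (R : Finset (Fin n)) :
    coeff (indExp R) (sumPderiv n p) = ∑ i ∈ Rᶜ, coeff (indExp (insert i R)) p := by
  rw [sumPderiv_apply, coeff_sum, ← Finset.sum_compl_add_sum R]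
  rw [Finset.sum_eq_zero (s := R), add_zero]
  · refine Finset.sum_congr rfl fun i hi => ?_
    have hi := Finset.mem_compl.1 hi
    rw [coeff_pderiv, indExp_add_single hi, indExp_apply, if_neg hi]
    simp
  · intro i hi
    rw [coeff_pderiv, hp.coeff_eq_zero (i := i), zero_mul]
    simp [indExp_apply, hi]

/-- The multilinear polynomial with given coefficients. -/
def multilinearPoly (n : ℕ) :
    EuclideanSpace ℝ (Finset (Fin n)) →ₗ[ℝ] MvPolynomial (Fin n) ℝ where
  toFun w := ∑ S, w S • setMonomial S
  map_add' w u := by simp [add_smul, Finset.sum_add_distrib]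
  map_smul' a w := by simp [mul_smul, Finset.smul_sum]

lemma multilinearPoly_apply (w : EuclideanSpace ℝ (Finset (Fin n))) :
    multilinearPoly n w = ∑ S, w S • setMonomial S := rfl

lemma isMultilinear_multilinearPoly (w : EuclideanSpace ℝ (Finset (Fin n))) :
    IsMultilinear (multilinearPoly n w) :=
  isMultilinear_sum _ _ fun S _ => (isMultilinear_setMonomial S).smul _

lemma coeff_multilinearPoly (w : EuclideanSpace ℝ (Finset (Fin n))) (S : Finset (Fin n)) :
    coeff (indExp S) (multilinearPoly n w) = w S := by
  simp [multilinearPoly_apply, coeff_sum, coeff_smul, coeff_setMonomial]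

lemma multilinearPoly_single (S : Finset (Fin n)) :
    multilinearPoly n (EuclideanSpace.single S 1) = setMonomial S := by
  simp [multilinearPoly_apply]

lemma IsMultilinear.sumPderiv {p : MvPolynomial (Fin n) ℝ} (hp : IsMultilinear p) :
    IsMultilinear (sumPderiv n p) := by
  refine isMultilinear_sum _ _ fun j _ i => ?_
  have : ∀ q : MvPolynomial (Fin n) ℝ, pderiv i (pderiv j q) = pderiv j (pderiv i q) := fun q =>
    congrArg (fun f : Module.End ℝ _ => f q) (pderiv_commute i j)
  rw [this, this, hp i, map_zero]

/-- Every square-free monomial is the sum of a harmonic polynomial and an element of the image of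
the up operator. -/
lemma exists_setMonomial_eq_add (S : Finset (Fin n)) :
    ∃ p q : MvPolynomial (Fin n) ℝ, setMonomial S = p + q ∧
      p ∈ Submodule.span ℝ (upPoly '' {R : Finset (Fin n) | R.card + 1 = S.card}) ∧
      IsMultilinear q ∧ q.IsHomogeneous S.card ∧ sumPderiv n q = 0 := by
  set u : Finset (Fin n) → EuclideanSpace ℝ (Finset (Fin n)) :=
    fun R => ∑ i ∈ Rᶜ, EuclideanSpace.single (insert i R) 1 with hu
  have hup : ∀ R, multilinearPoly n (u R) = upPoly R := fun R => by
    simp [hu, multilinearPoly_single, upPoly]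
  set K := Submodule.span ℝ (u '' {R : Finset (Fin n) | R.card + 1 = S.card})
  -- With the monomials orthonormal, the orthogonal complement of the image of the up operator is
  -- the kernel of its adjoint.
  obtain ⟨y, hy, z, hz, hyz⟩ := K.exists_add_mem_mem_orthogonal (EuclideanSpace.single S 1)
  have hsum : setMonomial S = multilinearPoly n y + multilinearPoly n z := by
    rw [← map_add, ← hyz, multilinearPoly_single]
  have hspan : multilinearPoly n y ∈
      Submodule.span ℝ (upPoly '' {R : Finset (Fin n) | R.card + 1 = S.card}) := by
    have := Submodule.mem_map_of_mem (f := multilinearPoly n) hy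
    rwa [Submodule.map_span, ← Set.image_comp,
      show multilinearPoly n ∘ u = upPoly from funext hup] at this
  have hyhom : multilinearPoly n y ∈ homogeneousSubmodule (Fin n) ℝ S.card := by
    refine Submodule.span_le.2 ?_ hspan
    rintro _ ⟨R, hR, rfl⟩
    have := upPoly_isHomogeneous R
    rwa [hR] at this
  have hzhom : multilinearPoly n z ∈ homogeneousSubmodule (Fin n) ℝ S.card := by
    rw [show multilinearPoly n z = setMonomial S - multilinearPoly n y by rw [hsum]; ring]
    exact Submodule.sub_mem _ (setMonomial_isHomogeneous S) hyhom
  have hzm := isMultilinear_multilinearPoly z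
  refine ⟨_, _, hsum, hspan, hzm, hzhom, ?_⟩
  rw [hzm.sumPderiv.eq_sum]
  refine Finset.sum_eq_zero fun R _ => ?_
  rw [coeff_sumPderiv_indExp hzm]
  refine smul_eq_zero_of_left ?_ _
  by_cases hR : R.card + 1 = S.card
  · have := (Submodule.mem_orthogonal _ _).1 hz (u R) (Submodule.subset_span ⟨R, hR, rfl⟩)
    simpa [hu, sum_inner, EuclideanSpace.inner_single_left, coeff_multilinearPoly] using this
  · refine Finset.sum_eq_zero fun i hi => ?_
    refine IsHomogeneous.coeff_eq_zero hzhom ?_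
    rwa [degree_indExp, Finset.card_insert_of_notMem (Finset.mem_compl.1 hi)]

variable (v : Fin n → EuclideanSpace ℝ (Fin (n - 1)))

/-- The product `∏_{j ∈ T} ⟨v_j, z⟩²`. -/
def sqProd (T : Multiset (Fin n)) : MvPolynomial (Fin (n - 1)) ℝ :=
  (T.map fun j => linForm (v j) ^ 2).prod

/-- The span of the products of multiharmonic polynomials with squares of the linear forms, of
total degree `d`. -/
def fischerSpan (d : ℕ) : Submodule ℝ (MvPolynomial (Fin (n - 1)) ℝ) :=
  Submodule.span ℝ {p | ∃ (T : Multiset (Fin n)) (q : MvPolynomial (Fin (n - 1)) ℝ),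
    2 * T.card ≤ d ∧ q ∈ multiharmonic v (d - 2 * T.card) ∧ p = q * sqProd v T}

variable {v}

lemma sq_mul_mem_fischerSpan {d : ℕ} {p : MvPolynomial (Fin (n - 1)) ℝ}
    (hp : p ∈ fischerSpan v d) (i : Fin n) : linForm (v i) ^ 2 * p ∈ fischerSpan v (d + 2) := by
  induction hp using Submodule.span_induction with
  | mem x hx =>
    obtain ⟨T, q, hT, hq, rfl⟩ := hx
    refine Submodule.subset_span ⟨i ::ₘ T, q, ?_, ?_, ?_⟩
    · rw [Multiset.card_cons]; omega
    · rw [Multiset.card_cons, show d + 2 - 2 * (T.card + 1) = d - 2 * T.card by omega]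
      exact hq
    · rw [sqProd, sqProd, Multiset.map_cons, Multiset.prod_cons]; ring
  | zero => simp
  | add x y _ _ hx hy => rw [mul_add]; exact Submodule.add_mem _ hx hy
  | smul c x _ hx => rw [mul_smul_comm]; exact Submodule.smul_mem _ c hx

lemma multiharmonic_le_fischerSpan (d : ℕ) : multiharmonic v d ≤ fischerSpan v d := fun q hq =>
  Submodule.subset_span ⟨0, q, by simp, by simpa using hq, by simp [sqProd]⟩

lemma sum_linForm (hv : IsSimplex v) : ∑ i, linForm (v i) = 0 := by
  simp only [linForm]
  rw [Finset.sum_comm]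
  refine Finset.sum_eq_zero fun j _ => ?_
  rw [← Finset.sum_mul, ← map_sum, hv.sum_apply, map_zero, zero_mul]

/-- Strong induction on degree: a repeated variable splits off a square. A square-free monomial is
harmonic up to the image of the up operator, which after substitution consists of squares times
terms of degree `d - 2`. -/
lemma simplexSubst_monomial_mem (hv : IsSimplex v) (hn : 2 ≤ n) (d : ℕ) :
    ∀ m : Fin n →₀ ℕ, m.degree = d → simplexSubst v (monomial m 1) ∈ fischerSpan v d := by
  induction d using Nat.strong_induction_on with
  | _ d ih =>
  intro m hm
  by_cases h : ∀ i, m i ≤ 1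
  · obtain ⟨S, rfl⟩ := exists_indExp h
    rw [degree_indExp] at hm
    obtain ⟨p, q, hpq, hp, hq, hqh, hqD⟩ := exists_setMonomial_eq_add S
    rw [← setMonomial_eq, hpq, map_add]
    refine Submodule.add_mem _ ?_ (multiharmonic_le_fischerSpan d
      (simplexSubst_mem_multiharmonic hv hn (hm ▸ hqh) hq hqD))
    have := Submodule.mem_map_of_mem (f := (simplexSubst v).toLinearMap) hp
    rw [Submodule.map_span] at this
    refine Submodule.span_le.2 ?_ this
    rintro _ ⟨_, ⟨R, hR, rfl⟩, rfl⟩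
    rw [AlgHom.toLinearMap_apply, upPoly_eq, map_sub, map_mul, map_sum]
    simp only [simplexSubst_X, sum_linForm hv, zero_mul, zero_sub, map_sum, map_mul, map_pow]
    refine Submodule.neg_mem _ (Submodule.sum_mem _ fun i hi => ?_)
    have hcard := Finset.card_erase_add_one hi
    rw [Set.mem_ofPred_eq] at hR
    rw [show d = (R.erase i).card + 2 by omega]
    refine sq_mul_mem_fischerSpan ?_ i
    rw [setMonomial_eq]
    exact ih _ (by omega) _ (degree_indExp _)
  · push Not at h
    obtain ⟨i, hi⟩ := h
    have hm' : Finsupp.single i 2 + (m - Finsupp.single i 2) = m :=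
      add_tsub_cancel_of_le (Finsupp.single_le_iff.2 hi)
    have hdeg := congrArg Finsupp.degree hm'
    rw [map_add, Finsupp.degree_single, hm] at hdeg
    have hX : monomial m (1 : ℝ) = X i ^ 2 * monomial (m - Finsupp.single i 2) 1 := by
      rw [X_pow_eq_monomial, monomial_mul, one_mul, hm']
    rw [hX, map_mul, map_pow, simplexSubst_X, ← hdeg, add_comm 2]
    exact sq_mul_mem_fischerSpan (ih _ (by omega) _ rfl) i

lemma exists_family_of_mem_fischerSpan {d : ℕ} {p : MvPolynomial (Fin (n - 1)) ℝ}
    (hp : p ∈ fischerSpan v d) : ∃ q : Multiset (Fin n) → MvPolynomial (Fin (n - 1)) ℝ,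
      (∀ T, 2 * T.card ≤ d → q T ∈ multiharmonic v (d - 2 * T.card)) ∧
      p = ∑ k ∈ Finset.range (d / 2 + 1), ∑ T : Sym (Fin n) k,
        q (T : Multiset (Fin n)) * sqProd v (T : Multiset (Fin n)) := by
  classical
  induction hp using Submodule.span_induction with
  | mem x hx =>
    obtain ⟨T, q, hT, hq, rfl⟩ := hx
    refine ⟨fun T' => if T' = T then q else 0, fun T' _ => ?_, ?_⟩
    · dsimp only
      split_ifs with h
      · rwa [h]
      · exact Submodule.zero_mem _
    · set T₀ : Sym (Fin n) T.card := ⟨T, rfl⟩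
      rw [Finset.sum_eq_single_of_mem T.card (Finset.mem_range.2 (by omega)),
        Finset.sum_eq_single_of_mem T₀ (Finset.mem_univ _)]
      · simp [T₀]
      · intro T' _ hT'
        exact (congrArg (· * _) (if_neg fun h => hT' (Subtype.ext h))).trans (zero_mul _)
      · intro k _ hk
        refine Finset.sum_eq_zero fun T' _ => ?_
        exact (congrArg (· * _) (if_neg fun h : (T' : Multiset (Fin n)) = T =>
          hk (h ▸ T'.2.symm))).trans (zero_mul _)
  | zero => exact ⟨fun _ => 0, fun _ _ => Submodule.zero_mem _, by simp⟩
  | add x y _ _ hx hy =>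
    obtain ⟨q, hq, rfl⟩ := hx
    obtain ⟨r, hr, rfl⟩ := hy
    exact ⟨q + r, fun T hT => Submodule.add_mem _ (hq T hT) (hr T hT), by
      simp [add_mul, Finset.sum_add_distrib]⟩
  | smul c x _ hx =>
    obtain ⟨q, hq, rfl⟩ := hx
    exact ⟨c • q, fun T hT => Submodule.smul_mem _ c (hq T hT), by simp [Finset.smul_sum]⟩

lemma exists_isFischer (hv : IsSimplex v) (hn : 2 ≤ n) (S : Finset (Fin n)) :
    ∃ h : Multiset (Fin n) → MvPolynomial (Fin n) ℝ, IsFischer v S h ∧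
      ∀ T, 2 * Multiset.card T ≤ S.card → (h T).IsHomogeneous (S.card - 2 * Multiset.card T) := by
  obtain ⟨q, hq, hsum⟩ := exists_family_of_mem_fischerSpan
    (simplexSubst_monomial_mem hv hn S.card (indExp S) (degree_indExp S))
  refine ⟨fun T => simplexLift v (q T), ⟨fun T hT => ?_, ?_⟩, fun T hT =>
    simplexLift_isHomogeneous v (mem_multiharmonic_iff.1 (hq T hT)).1⟩
  · rw [simplexSubst_simplexLift hv hn]; exact hq T hT
  · simp only [simplexSubst_simplexLift hv hn]
    rw [← setMonomial_eq, setMonomial, map_prod] at hsum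
    simpa [sqProd] using hsum

/-! ### The Gram matrix expression -/

/-- The lift of `⟨v_j, z⟩²` is not `x_j²`, but the two agree on the hyperplane, so in the allowed
degrees `Ẽ` may use `x_j²` and drop it. -/
lemma pseudoE_simplexLift_sqProd_mul (hv : IsSimplex v) (hn : 2 ≤ n) (T : Multiset (Fin n))
    {p : MvPolynomial (Fin (n - 1)) ℝ} {e : ℕ} (hp : p.IsHomogeneous e)
    (h : Even n ∨ 2 * T.card + e ≤ n) :
    pseudoE n (simplexLift v (sqProd v T * p)) = pseudoE n (simplexLift v p) := by
  have hs : sqProd v T * p =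
      simplexSubst v ((T.map fun j => X j ^ 2).prod * simplexLift v p) := by
    rw [map_mul, simplexSubst_simplexLift hv hn, map_multiset_prod, Multiset.map_map, sqProd]
    simp
  rw [hs, pseudoE_simplexLift_simplexSubst hv hn, pseudoE_prod_sq_mul]
  refine h.imp_right fun h => (totalDegree_mul _ _).trans (le_trans (add_le_add ?_
    (simplexLift_isHomogeneous v hp).totalDegree_le) h)
  refine (totalDegree_multiset_prod _).trans ?_
  simp [Multiset.map_map, totalDegree_X_pow, mul_comm]

/-- Reindexes by the residual degree `d = s - 2k`, padding the wrong parities with zeros to match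
`fischerPart`. -/
lemma sum_range_half {M : Type*} [AddCommMonoid M] (s : ℕ) (g : ℕ → M) :
    ∑ k ∈ Finset.range (s / 2 + 1), g k =
      ∑ d ∈ Finset.range (s + 1), if d ≤ s ∧ d % 2 = s % 2 then g ((s - d) / 2) else 0 := by
  rw [← Finset.sum_filter]
  refine Finset.sum_nbij' (fun k => s - 2 * k) (fun d => (s - d) / 2) ?_ ?_ ?_ ?_ ?_
  · intro k hk
    simp only [Finset.mem_range, Finset.mem_filter] at hk ⊢
    omega
  · intro d hd
    simp only [Finset.mem_range, Finset.mem_filter] at hd ⊢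
    omega
  · intro k hk
    simp only [Finset.mem_range] at hk
    omega
  · intro d hd
    simp only [Finset.mem_range, Finset.mem_filter] at hd
    omega
  · intro k hk
    simp only [Finset.mem_range] at hk
    rw [show (s - (s - 2 * k)) / 2 = k by omega]

lemma IsFischer.fischerPart_mem {S : Finset (Fin n)}
    {h : Multiset (Fin n) → MvPolynomial (Fin n) ℝ} (hF : IsFischer v S h) (d : ℕ) :
    simplexSubst v (fischerPart S h d) ∈ multiharmonic v d := by
  rw [fischerPart]
  split_ifs with hd
  · rw [map_sum]
    refine Submodule.sum_mem _ fun T _ => ?_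
    have hc : Multiset.card (T : Multiset (Fin n)) = (S.card - d) / 2 := T.2
    have := hF.mem_multiharmonic T (by omega)
    rwa [hc, show S.card - 2 * ((S.card - d) / 2) = d by omega] at this
  · rw [map_zero]; exact Submodule.zero_mem _

/-- All square factors disappear under `Ẽ`, so terms with the same `|T|` merge into one
`fischerPart`. -/
lemma IsFischer.pseudoE_prod_mul (hv : IsSimplex v) (hn : 2 ≤ n) {S : Finset (Fin n)}
    {h : Multiset (Fin n) → MvPolynomial (Fin n) ℝ} (hF : IsFischer v S h)
    {r : MvPolynomial (Fin (n - 1)) ℝ} {e : ℕ} (hr : r.IsHomogeneous e)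
    (hS : Even n ∨ S.card + e ≤ n) :
    pseudoE n (simplexLift v ((∏ i ∈ S, linForm (v i)) * r)) =
      ∑ d ∈ Finset.range (S.card + 1),
        pseudoE n (simplexLift v (simplexSubst v (fischerPart S h d) * r)) := by
  rw [hF.prod_eq, Finset.sum_mul, map_sum, map_sum]
  have : ∀ k ∈ Finset.range (S.card / 2 + 1),
      pseudoE n (simplexLift v ((∑ T : Sym (Fin n) k, simplexSubst v (h (T : Multiset (Fin n))) *
        ((T : Multiset (Fin n)).map fun j => linForm (v j) ^ 2).prod) * r)) =
      pseudoE n (simplexLift v (simplexSubst v (∑ T : Sym (Fin n) k,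
        h (T : Multiset (Fin n))) * r)) := by
    intro k hk
    have hk : 2 * k ≤ S.card := by have := Finset.mem_range.1 hk; omega
    simp only [Finset.sum_mul, map_sum]
    refine Finset.sum_congr rfl fun T _ => ?_
    have hc : Multiset.card (T : Multiset (Fin n)) = k := T.2
    have hmem := (mem_multiharmonic_iff.1 (hF.mem_multiharmonic T (by omega))).1
    rw [mul_right_comm, mul_comm, ← sqProd,
      pseudoE_simplexLift_sqProd_mul hv hn _ (hmem.mul hr)]
    refine hS.imp_right fun hS => ?_
    omega
  rw [Finset.sum_congr rfl this, sum_range_half]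
  refine Finset.sum_congr rfl fun d _ => ?_
  rw [fischerPart]
  split_ifs <;> simp

lemma IsFischer.pseudoE_setMonomial_mul (hv : IsSimplex v) (hn : 2 ≤ n) {S T : Finset (Fin n)}
    {g h : Multiset (Fin n) → MvPolynomial (Fin n) ℝ} (hg : IsFischer v S g)
    (hh : IsFischer v T h) (hST : Even n ∨ S.card + T.card ≤ n) :
    pseudoE n (setMonomial S * setMonomial T) =
      ∑ d ∈ Finset.range (min S.card T.card + 1), sigmaSq n d *
        apolar (simplexSubst v (fischerPart S g d)) (simplexSubst v (fischerPart T h d)) := by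
  have hdeg : (∏ i ∈ T, linForm (v i)).IsHomogeneous T.card := by
    simpa using IsHomogeneous.prod T _ (fun _ => 1) fun i _ => linForm_isHomogeneous (v i)
  rw [← pseudoE_simplexLift_simplexSubst hv hn _ (hST.imp_right fun h =>
    ((setMonomial_isHomogeneous S).mul (setMonomial_isHomogeneous T)).totalDegree_le.trans h),
    map_mul]
  simp only [setMonomial, map_prod, simplexSubst_X]
  rw [hg.pseudoE_prod_mul hv hn hdeg hST]
  have hinner : ∀ d ∈ Finset.range (S.card + 1),
      pseudoE n (simplexLift v (simplexSubst v (fischerPart S g d) * ∏ i ∈ T, linForm (v i))) =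
      if d ∈ Finset.range (T.card + 1) then sigmaSq n d *
        apolar (simplexSubst v (fischerPart S g d)) (simplexSubst v (fischerPart T h d))
      else 0 := by
    intro d hd
    have hd := Finset.mem_range.1 hd
    rw [mul_comm, hh.pseudoE_prod_mul hv hn (mem_multiharmonic_iff.1 (hg.fischerPart_mem d)).1
      (hST.imp_right fun h => by omega), ← Finset.sum_ite_eq (Finset.range (T.card + 1)) d
      fun d => sigmaSq n d *
        apolar (simplexSubst v (fischerPart S g d)) (simplexSubst v (fischerPart T h d))]
    -- Only `e = d` survives: distinct degrees are orthogonal, and the diagonal term is the apolar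
    -- pairing.
    refine Finset.sum_congr rfl fun e he => ?_
    have he := Finset.mem_range.1 he
    rw [mul_comm, map_mul]
    split_ifs with hde
    · subst hde
      exact pseudoE_mul_eq_apolar hv hn (hST.imp_right fun h => by omega)
        (hg.fischerPart_mem d) (hh.fischerPart_mem d)
    · exact pseudoE_mul_eq_zero hv hde (hg.fischerPart_mem d) (hh.fischerPart_mem e)
  rw [Finset.sum_congr rfl hinner, ← Finset.sum_filter]
  refine Finset.sum_congr ?_ fun _ _ => rfl
  ext d
  simp only [Finset.mem_filter, Finset.mem_range]
  omega

lemma IsFischer.apolar_gramPoly (hn : 2 ≤ n) {S T : Finset (Fin n)}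
    {g h : Multiset (Fin n) → MvPolynomial (Fin n) ℝ} (hg : IsFischer v S g)
    (hh : IsFischer v T h) (hST : Even n ∨ S.card + T.card ≤ n) :
    apolar (gramPoly v S g) (gramPoly v T h) =
      ∑ d ∈ Finset.range (min S.card T.card + 1), sigmaSq n d *
        apolar (simplexSubst v (fischerPart S g d)) (simplexSubst v (fischerPart T h d)) := by
  rw [gramPoly, gramPoly,
    apolar_sum_sum (fun d => (mem_multiharmonic_iff.1 (hg.fischerPart_mem d)).1)
      (fun d => (mem_multiharmonic_iff.1 (hh.fischerPart_mem d)).1),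
    Nat.add_min_add_right]
  refine Finset.sum_congr rfl fun d hd => ?_
  have hd := Finset.mem_range.1 hd
  -- For odd `n`, the bound `|S| + |T| ≤ n` puts every `d ≤ min(|S|, |T|)` in the range where `σ_d²`
  -- is positive.
  rw [Real.mul_self_sqrt (sigmaSq_nonneg hn (hST.imp_right fun h => by omega))]

end Fischer

end

end GrigorievLaurent

theorem mainTheorem4 (n : ℕ) (hn : 2 ≤ n)
    (v : Fin n → EuclideanSpace ℝ (Fin (n - 1))) (hv : IsSimplex v) :
    -- positivity of the constants
    (∀ d ≤ n / 2, 0 < sigmaSq n d) ∧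
    -- block diagonalization by the isotypic projections `h_S`
    (∀ S T : Finset (Fin n), S.card ≤ n / 2 → T.card ≤ n / 2 →
      (S.card ≠ T.card → pseudoE n (isoProj S * isoProj T) = 0) ∧
      (S.card = T.card → pseudoE n (isoProj S * isoProj T) =
        sigmaSq n S.card * apolar (simplexSubst v (isoProj S)) (simplexSubst v (isoProj T)))) ∧
    -- Fischer decompositions exist, with homogeneous `h_{S,T}`
    (∃ h : Finset (Fin n) → Multiset (Fin n) → MvPolynomial (Fin n) ℝ,
      (∀ S, IsFischer v S (h S)) ∧
      ∀ S T, 2 * Multiset.card T ≤ S.card → (h S T).IsHomogeneous (S.card - 2 * Multiset.card T)) ∧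
    -- for every choice of them, the pseudoexpectation is the Gram matrix of their components
    (∀ h : Finset (Fin n) → Multiset (Fin n) → MvPolynomial (Fin n) ℝ,
      (∀ S, IsFischer v S (h S)) →
      ∀ S T : Finset (Fin n), (Even n ∨ S.card + T.card ≤ n) →
        pseudoE n (setMonomial S * setMonomial T) =
          ∑ d ∈ Finset.range (min S.card T.card + 1), sigmaSq n d *
            apolar (simplexSubst v (fischerPart S (h S) d)) (simplexSubst v (fischerPart T (h T) d)) ∧
        pseudoE n (setMonomial S * setMonomial T) =
          apolar (gramPoly v S (h S)) (gramPoly v T (h T))) := by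
  refine ⟨fun d hd => sigmaSq_pos hn hd, fun S T hS hT => ⟨fun hne => ?_, fun heq => ?_⟩, ?_, ?_⟩
  · rw [pseudoE_isoProj_mul hv hn S T (by omega)]
    exact pseudoE_mul_eq_zero hv hne (simplexSubst_isoProj_mem hv hn S)
      (simplexSubst_isoProj_mem hv hn T)
  · rw [pseudoE_isoProj_mul hv hn S T (by omega)]
    exact pseudoE_mul_eq_apolar hv hn (Or.inr (by omega)) (simplexSubst_isoProj_mem hv hn S)
      (heq ▸ simplexSubst_isoProj_mem hv hn T)
  · choose h hF hhom using exists_isFischer hv hn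
    exact ⟨h, hF, hhom⟩
  · intro h hF S T hST
    have hE := IsFischer.pseudoE_setMonomial_mul hv hn (hF S) (hF T) hST
    exact ⟨hE, hE.trans (IsFischer.apolar_gramPoly hn (hF S) (hF T) hST).symm⟩
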